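/- Let $q\in(0,1)$ and let $k,l$ be coprime positive integers. Let $V_1,\dots,V_l$ be copies of the Hilbert space $\ell^2(\mathbb N)$, $V_s$ with orthonormal basis $(e^s_p)_{p\ge 0}$, and let $\mathcal K_s$ be the $C^*$-algebra of all compact operators on $V_s$. Let $\pi_s(a),\pi_s(b)$ be the bounded operators on $V_s$ with $$\pi_s(a)e^s_p=q^{2(lp+s)}e^s_p,\qquad \pi_s(b)e^s_p=q^{k(lp+s)}\prod_{r=1}^{l}\bigl(1-q^{2(lp+s-r)}\bigr)^{1/2}e^s_{p-1}\ (p\ge1),\qquad \pi_s(b)e^s_0=0 .$$ Let $C(\mathbb{WP}_q(k,l))$ be the norm closure, in the bounded operators on $\bigoplus_{s=1}^{l}V_s$, of the unital $*$-algebra generated by $a:=\bigoplus_s\pi_s(a)$ and $b:=\bigoplus_s\pi_s(b)$. Then: 1. $C(\mathbb{WP}_q(k,l))$, with $a$ and $b$, is the universal unital $C^*$-algebra for the relations $$a^*=a,\quad ab=q^{-2l}ba,\quad bb^*=q^{2kl}a^k\prod_{m=0}^{l-1}(1-q^{2m}a),\quad b^*b=a^k\prod_{m=1}^{l}(1-q^{-2m}a);$$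 that is, $a,b$ satisfy the relations and generate it as a unital $C^*$-algebra, and for any two elements $c,d$ of a unital $C^*$-algebra $B$ that satisfy the same relations there is a (necessarily unique) unital $*$-homomorphism $C(\mathbb{WP}_q(k,l))\to B$ with $a\mapsto c$, $b\mapsto d$. Any other universal $C^*$-algebra for these relations is isomorphic to it by a $*$-isomorphism that matches the generators. 2. There is a split exact sequence of $C^*$-algebras and $*$-homomorphisms $$0\longrightarrow\bigoplus_{s=1}^{l}\mathcal K_s\overset{\iota}{\longrightarrow} C(\mathbb{WP}_q(k,l))\overset{\varepsilon}{\longrightarrow}\mathbb C\longrightarrow 0,$$ where $\iota(T_1,\dots,T_l)=T_1\oplus\cdots\oplus T_l$ acts on $\bigoplus_sV_s$, $\varepsilon$ is unital with $\varepsilon(a)=\varepsilon(b)=0$, and the splitting $\mathbb C\to C(\mathbb{WP}_q(k,l))$ is a unital $*$-homomorphism. 3. Hence $C(\mathbb{WP}_q(k,l))$ is $*$-isomorphic to the $C^*$-algebra obtained from the direct sum $\bigoplus_{s=1}^{l}\mathcal K_s$ of $l$ copies of the compact operators by adjoining one identity. -/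

import Mathlib

open scoped ENNReal

universe u v

noncomputable section

namespace WPq

/-! ## Compact operators and exact sequences -/

/-- The Hilbert space adjoint of a compact operator is compact. -/
theorem isCompactOperator_star {E : Type*} [NormedAddCommGroup E] [InnerProductSpace ℂ E]
    [CompleteSpace E] {T : E →L[ℂ] E} (hT : IsCompactOperator T) :
    IsCompactOperator (star T : E →L[ℂ] E) := by
  have hS : IsCompactOperator (T ∘ (star T : E →L[ℂ] E)) := hT.comp_clm (star T)
  have hS' : IsCompactOperator (T ∘L (star T : E →L[ℂ] E)) := hS
  have h1 : TotallyBounded ((T ∘L (star T : E →L[ℂ] E)) '' Metric.ball 0 1) :=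
    (hS'.isCompact_closure_image_ball 1).totallyBounded.subset subset_closure
  refine (isCompactOperator_iff_isCompact_closure_image_ball
    ((star T : E →L[ℂ] E) : E →ₗ[ℂ] E) one_pos).2 ?_
  refine TotallyBounded.isCompact_of_isClosed ?_ isClosed_closure
  refine TotallyBounded.closure ?_
  rw [Metric.totallyBounded_iff]
  intro ε hε
  obtain ⟨t, hts, htf, hcov⟩ := (totallyBounded_iff_subset.1 h1) _
    (Metric.dist_mem_uniformity (show 0 < ε ^ 2 / 2 by positivity))
  obtain ⟨t', ht's, ht'f, rfl⟩ := Set.exists_subset_image_finite_and.1 ⟨t, hts, htf, rfl⟩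
  refine ⟨(star T : E →L[ℂ] E) '' t', ht'f.image _, ?_⟩
  rintro _ ⟨x, hx, rfl⟩
  obtain ⟨_, hy⟩ := Set.mem_iUnion.1 (hcov ⟨x, hx, rfl⟩)
  obtain ⟨⟨y, hyt, rfl⟩, hy2⟩ := Set.mem_iUnion.1 hy
  refine Set.mem_iUnion₂.2 ⟨_, ⟨y, hyt, rfl⟩, ?_⟩
  have hd : ‖T ((star T : E →L[ℂ] E) (x - y))‖ < ε ^ 2 / 2 := by
    have : dist (T ((star T : E →L[ℂ] E) x)) (T ((star T : E →L[ℂ] E) y)) < ε ^ 2 / 2 := hy2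
    rwa [dist_eq_norm, ← map_sub, ← map_sub] at this
  have hxy : ‖x - y‖ < 2 := by
    have h1 : ‖x‖ < 1 := by simpa using hx
    have h2 : ‖y‖ < 1 := by simpa using ht's hyt
    linarith [norm_sub_le x y]
  have key : ‖(star T : E →L[ℂ] E) (x - y)‖ ^ 2
      ≤ ‖T ((star T : E →L[ℂ] E) (x - y))‖ * ‖x - y‖ := by
    have h := ContinuousLinearMap.adjoint_inner_right T ((star T : E →L[ℂ] E) (x - y)) (x - y)
    rw [← ContinuousLinearMap.star_eq_adjoint, inner_self_eq_norm_sq_to_K] at h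
    have h' := norm_inner_le_norm (𝕜 := ℂ) (T ((star T : E →L[ℂ] E) (x - y))) (x - y)
    rw [← h] at h'
    simpa using h'
  have hlt : ‖(star T : E →L[ℂ] E) (x - y)‖ ^ 2 < ε ^ 2 := by
    nlinarith [norm_nonneg (x - y), norm_nonneg (T ((star T : E →L[ℂ] E) (x - y)))]
  have := lt_of_pow_lt_pow_left₀ 2 hε.le hlt
  rw [map_sub] at this
  simpa [Metric.mem_ball, dist_eq_norm] using this

/-- The C*-algebra of all compact operators on a Hilbert space `E`. -/
def compactOps (E : Type*) [NormedAddCommGroup E] [InnerProductSpace ℂ E] [CompleteSpace E] :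
    NonUnitalStarSubalgebra ℂ (E →L[ℂ] E) where
  carrier := {T | IsCompactOperator T}
  add_mem' := fun hS hT => IsCompactOperator.add hS hT
  zero_mem' := isCompactOperator_zero
  smul_mem' := fun c _ hT => IsCompactOperator.smul hT c
  mul_mem' := fun {_ T} hS _ => IsCompactOperator.comp_clm hS T
  star_mem' := fun hT => isCompactOperator_star hT

instance instIsClosedCompactOps (E : Type*) [NormedAddCommGroup E] [InnerProductSpace ℂ E]
    [CompleteSpace E] : IsClosed (compactOps E : Set (E →L[ℂ] E)) :=
  isClosed_setOfPred_isCompactOperator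

/-- `0 → I → A → Q → 0` is a short exact sequence of C*-algebras and `σ` is a splitting of it:
all the maps are *-homomorphisms, `ι` is injective, the range of `ι` is the kernel of `ε`,
`ε` is surjective, and `ε ∘ σ` is the identity of `Q`. -/
structure IsSplitExact {I A Q : Type*} [NonUnitalCStarAlgebra I] [CStarAlgebra A] [CStarAlgebra Q]
    (ι : I →⋆ₙₐ[ℂ] A) (ε : A →⋆ₐ[ℂ] Q) (σ : Q →⋆ₐ[ℂ] A) : Prop where
  injective : Function.Injective ι
  exact : ∀ x : A, ε x = 0 ↔ ∃ t : I, ι t = x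
  surjective : Function.Surjective ε
  split : ∀ z : Q, ε (σ z) = z

/-! ## The relations and the universal C*-algebra -/

/-- The defining relations of the coordinate algebra of the quantum weighted projective line,
for two elements `a`, `b` of a unital C*-algebra. The products are those of (commuting) polynomials
in `a`; `∏_{m=1}^{l}` is written with `m + 1` for `m < l`. -/
structure Relations (q : ℝ) (k l : ℕ) {A : Type*} [CStarAlgebra A] (a b : A) : Prop where
  star_a : star a = a
  a_mul_b : a * b = ((q : ℂ) ^ (-(2 * l : ℤ))) • (b * a)
  b_mul_star_b : b * star b = ((q : ℂ) ^ (2 * k * l)) •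
    (a ^ k * ((List.range l).map fun m : ℕ => 1 - ((q : ℂ) ^ (2 * m)) • a).prod)
  star_b_mul_b : star b * b =
    a ^ k * ((List.range l).map fun m : ℕ => 1 - ((q : ℂ) ^ (-(2 * ((m : ℤ) + 1)))) • a).prod

/-- `A`, with the elements `a` and `b`, is the universal unital C*-algebra for the relations:
`a` and `b` satisfy the relations and generate `A` as a C*-algebra, and for any `c`, `d` in a
unital C*-algebra `B` that satisfy the relations there is a unital *-homomorphism `A → B` with
`a ↦ c`, `b ↦ d` (unique, because `a` and `b` generate). `B` ranges over all C*-algebras in the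
universe `v`. -/
structure IsUniversal (q : ℝ) (k l : ℕ) {A : Type u} [CStarAlgebra A] (a b : A) : Prop where
  relations : Relations q k l a b
  generate : (StarAlgebra.adjoin ℂ ({a, b} : Set A)).topologicalClosure = ⊤
  lift : ∀ (B : Type v) [CStarAlgebra B] (c d : B), Relations q k l c d →
    ∃ φ : A →⋆ₐ[ℂ] B, φ a = c ∧ φ b = d

/-! ## The representations `π_s` and the concrete C*-algebra -/

/-- The Hilbert space `ℓ²(ℕ)`, on which each representation `π_s` acts (`V_s = V` for all `s`);
its orthonormal basis is `e_p = lp.single 2 p 1`. -/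
abbrev V : Type := lp (fun _ : ℕ => ℂ) 2

/-- The Hilbert space direct sum of `l` copies of `V`. -/
abbrev VSum (l : ℕ) : Type := PiLp 2 (fun _ : Fin l => V)

theorem memlp_weighted {w : ℕ → ℝ} (hw : ∀ p, |w p| ≤ 1) {τ : ℕ → ℕ}
    (hτ : Function.Injective τ) (x : V) :
    Summable (fun p => ‖(w p : ℂ) * x (τ p)‖ ^ 2) ∧
      ∑' p, ‖(w p : ℂ) * x (τ p)‖ ^ 2 ≤ ∑' p, ‖x p‖ ^ 2 := by
  have hx : Summable (fun p => ‖x p‖ ^ 2) := by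
    have := (lp.memℓp x).summable (by norm_num)
    simpa using this
  have hle : ∀ p, ‖(w p : ℂ) * x (τ p)‖ ^ 2 ≤ ‖x (τ p)‖ ^ 2 := by
    intro p
    have h1 : ‖(w p : ℂ) * x (τ p)‖ ≤ ‖x (τ p)‖ := by
      rw [norm_mul, Complex.norm_real, Real.norm_eq_abs]
      exact mul_le_of_le_one_left (norm_nonneg _) (hw p)
    exact pow_le_pow_left₀ (norm_nonneg _) h1 2
  have hxτ : Summable (fun p => ‖x (τ p)‖ ^ 2) := hx.comp_injective hτ
  have hs : Summable (fun p => ‖(w p : ℂ) * x (τ p)‖ ^ 2) :=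
    hxτ.of_nonneg_of_le (fun _ => by positivity) hle
  refine ⟨hs, (hs.tsum_le_tsum hle hxτ).trans ?_⟩
  exact hxτ.tsum_le_tsum_of_inj τ hτ (fun _ _ => by positivity) (fun _ => le_rfl) hx

/-- The bounded operator `(T x)_p = w_p x_{τ(p)}` on `ℓ²(ℕ)`, for an injective map `τ` and real
weights with `|w_p| ≤ 1`. -/
def weightedOp (w : ℕ → ℝ) (hw : ∀ p, |w p| ≤ 1) (τ : ℕ → ℕ) (hτ : Function.Injective τ) :
    V →L[ℂ] V :=
  LinearMap.mkContinuous
    { toFun := fun x => ⟨fun p => (w p : ℂ) * x (τ p), by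
        refine memℓp_gen ?_
        simpa using (memlp_weighted hw hτ x).1⟩
      map_add' := fun x y => by
        ext p
        exact mul_add _ _ _
      map_smul' := fun c x => by ext p; simp [mul_left_comm] } 1 (by
    intro x
    rw [one_mul]
    have h0 : (0 : ℝ) < (2 : ℝ≥0∞).toReal := by norm_num
    rw [lp.norm_eq_tsum_rpow h0, lp.norm_eq_tsum_rpow h0]
    refine Real.rpow_le_rpow (tsum_nonneg fun _ => by positivity) ?_ (by norm_num)
    simpa using (memlp_weighted hw hτ x).2)

@[simp] theorem weightedOp_apply (w : ℕ → ℝ) (hw : ∀ p, |w p| ≤ 1) (τ : ℕ → ℕ)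
    (hτ : Function.Injective τ) (x : V) (p : ℕ) :
    weightedOp w hw τ hτ x p = (w p : ℂ) * x (τ p) := rfl

/-- The eigenvalue `q^{2(lp+s)}` of `π_s(a)` on `e_p`. -/
def aCoeff (q : ℝ) (l s p : ℕ) : ℝ := q ^ (2 * (l * p + s))

/-- The coefficient `q^{k(lp+s)} ∏_{r=1}^{l} (1 - q^{2(lp+s-r)})^{1/2}` of `e_{p-1}` in
`π_s(b) e_p`. -/
def bCoeff (q : ℝ) (k l s p : ℕ) : ℝ :=
  q ^ (k * (l * p + s)) *
    ∏ r ∈ Finset.Icc 1 l, Real.sqrt (1 - q ^ (2 * ((l : ℤ) * p + s - r)))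

theorem abs_aCoeff_le {q : ℝ} (hq : q ∈ Set.Ioo (0 : ℝ) 1) (l s p : ℕ) :
    |aCoeff q l s p| ≤ 1 := by
  rw [aCoeff, abs_of_nonneg (pow_nonneg hq.1.le _)]
  exact pow_le_one₀ hq.1.le hq.2.le

theorem abs_bCoeff_le {q : ℝ} (hq : q ∈ Set.Ioo (0 : ℝ) 1) (k l s p : ℕ) :
    |bCoeff q k l s p| ≤ 1 := by
  have h1 : 0 ≤ ∏ r ∈ Finset.Icc 1 l, Real.sqrt (1 - q ^ (2 * ((l : ℤ) * p + s - r))) :=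
    Finset.prod_nonneg fun _ _ => Real.sqrt_nonneg _
  have h2 : ∏ r ∈ Finset.Icc 1 l, Real.sqrt (1 - q ^ (2 * ((l : ℤ) * p + s - r))) ≤ 1 := by
    refine Finset.prod_le_one (fun _ _ => Real.sqrt_nonneg _) fun r _ => ?_
    rw [Real.sqrt_le_one]
    linarith [zpow_pos hq.1 (2 * ((l : ℤ) * p + s - r))]
  rw [bCoeff, abs_of_nonneg (mul_nonneg (pow_nonneg hq.1.le _) h1)]
  exact mul_le_one₀ (pow_le_one₀ hq.1.le hq.2.le) h1 h2

/-- `π_s(a)`: the diagonal operator `e_p ↦ q^{2(lp+s)} e_p`. -/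
def piA {q : ℝ} (hq : q ∈ Set.Ioo (0 : ℝ) 1) (l s : ℕ) : V →L[ℂ] V :=
  weightedOp (aCoeff q l s) (abs_aCoeff_le hq l s) id Function.injective_id

/-- `π_s(b)`: the weighted backward shift with `e_0 ↦ 0` and, for `p ≥ 1`,
`e_p ↦ q^{k(lp+s)} ∏_{r=1}^{l} (1 - q^{2(lp+s-r)})^{1/2} e_{p-1}`. In coordinates,
the `p`-th entry of `π_s(b) x` is the coefficient with index `p + 1` times `x_{p+1}`. -/
def piB {q : ℝ} (hq : q ∈ Set.Ioo (0 : ℝ) 1) (k l s : ℕ) : V →L[ℂ] V :=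
  weightedOp (fun p => bCoeff q k l s (p + 1)) (fun p => abs_bCoeff_le hq k l s (p + 1))
    Nat.succ Nat.succ_injective

theorem piA_basis {q : ℝ} (hq : q ∈ Set.Ioo (0 : ℝ) 1) (l s p : ℕ) :
    piA hq l s (lp.single 2 p (1 : ℂ)) = (aCoeff q l s p : ℂ) • lp.single 2 p (1 : ℂ) := by
  ext n
  by_cases h : n = p
  · subst h; simp [piA, -Complex.coe_smul]
  · simp [piA, h, -Complex.coe_smul]

theorem piB_basis_zero {q : ℝ} (hq : q ∈ Set.Ioo (0 : ℝ) 1) (k l s : ℕ) :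
    piB hq k l s (lp.single 2 0 (1 : ℂ)) = 0 := by
  ext n
  simp [piB]

theorem piB_basis_succ {q : ℝ} (hq : q ∈ Set.Ioo (0 : ℝ) 1) (k l s p : ℕ) :
    piB hq k l s (lp.single 2 (p + 1) (1 : ℂ)) =
      (bCoeff q k l s (p + 1) : ℂ) • lp.single 2 p (1 : ℂ) := by
  ext n
  by_cases h : n = p
  · subst h; simp [piB, -Complex.coe_smul]
  · simp [piB, h, -Complex.coe_smul]

/-- The direct sum of the operators `T s`, acting on the direct sum of the spaces `V_s`. -/
def blockDiag {l : ℕ} (T : Fin l → (V →L[ℂ] V)) : VSum l →L[ℂ] VSum l :=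
  ((PiLp.continuousLinearEquiv 2 ℂ (fun _ : Fin l => V)).symm :
      (Fin l → V) →L[ℂ] VSum l) ∘L
    ContinuousLinearMap.piMap T ∘L
      (PiLp.continuousLinearEquiv 2 ℂ (fun _ : Fin l => V) : VSum l →L[ℂ] (Fin l → V))

@[simp] theorem blockDiag_apply {l : ℕ} (T : Fin l → (V →L[ℂ] V)) (x : VSum l) (s : Fin l) :
    blockDiag T x s = T s (x s) := rfl

/-- The image of `a` under `π_1 ⊕ ⋯ ⊕ π_l`; the summand with index `s : Fin l` is `π_{s+1}`. -/
def sumA {q : ℝ} (hq : q ∈ Set.Ioo (0 : ℝ) 1) (l : ℕ) : VSum l →L[ℂ] VSum l :=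
  blockDiag fun s : Fin l => piA hq l (s + 1)

/-- The image of `b` under `π_1 ⊕ ⋯ ⊕ π_l`. -/
def sumB {q : ℝ} (hq : q ∈ Set.Ioo (0 : ℝ) 1) (k l : ℕ) : VSum l →L[ℂ] VSum l :=
  blockDiag fun s : Fin l => piB hq k l (s + 1)

/-- The C*-algebra of continuous functions on the quantum weighted projective line, as a concrete
algebra: the norm closure, in the bounded operators on the sum of the `V_s`, of the image of the
coordinate algebra (that is, of the unital *-algebra generated by the images of `a` and `b`) under
`π_1 ⊕ ⋯ ⊕ π_l`. -/
def CWP {q : ℝ} (hq : q ∈ Set.Ioo (0 : ℝ) 1) (k l : ℕ) :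
    StarSubalgebra ℂ (VSum l →L[ℂ] VSum l) :=
  (StarAlgebra.adjoin ℂ {sumA hq l, sumB hq k l}).topologicalClosure

instance instIsClosedCWP {q : ℝ} (hq : q ∈ Set.Ioo (0 : ℝ) 1) (k l : ℕ) :
    IsClosed (CWP hq k l : Set (VSum l →L[ℂ] VSum l)) :=
  StarSubalgebra.isClosed_topologicalClosure _

/-- The generator `a` of the concrete algebra. -/
def genA {q : ℝ} (hq : q ∈ Set.Ioo (0 : ℝ) 1) (k l : ℕ) : CWP hq k l :=
  ⟨sumA hq l, StarSubalgebra.le_topologicalClosure _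
    (StarAlgebra.subset_adjoin ℂ _ (Set.mem_insert _ _))⟩

/-- The generator `b` of the concrete algebra. -/
def genB {q : ℝ} (hq : q ∈ Set.Ioo (0 : ℝ) 1) (k l : ℕ) : CWP hq k l :=
  ⟨sumB hq k l, StarSubalgebra.le_topologicalClosure _
    (StarAlgebra.subset_adjoin ℂ _ (Set.mem_insert_of_mem _ rfl))⟩

end WPq

end

open WPq

/-! ## Functional calculus and generation -/

namespace WPq

/-! The relations force the spectrum of `a`. Since `b` intertwines `a` with `q^{-2l} a` and `b⋆ b =
h(a)`, a spectral point `x` with `h(x) ≠ 0` yields the spectral point `q^{-2l} x`. Boundedness makes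
this stop at a zero of `h`, so every nonzero spectral point is some `q^{2(lp+s)}` with `1 ≤ s ≤ l`
(`Relations.mem_spectrum`). The spectral projections at these points are cut out by tent functions,
`b` shifts them down by `l`, and `b` kills the first `l` of them. Hence the normalised elements
`b⋆^p P b^r`, with `P` one of the first `l` projections, behave like matrix units in any C*-algebra
with the relations.

Rigidity: let `A` be generated by `a`, `b` with the relations and let `π` send them to the concrete
operators. A compression of `x` by two spectral projections is a matrix entry of `π x` times a
matrix unit (`Relations.proj_mul_mul_proj`), so it vanishes if `π x = 0`. Moreover `a`, `b`, `b⋆`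
tend to zero against the complementary projections `cut`, because `k > 0` makes `b⋆ b` and `b b⋆`
multiples of `a`. So every `x` does too, up to the scalar given by the character pulled back along
`π`. If `π x = 0` this scalar is zero and `x = 0`. Thus `π` is bijective
(`bijective_of_generators`).

The character comes from the concrete side. The operators `a`, `b` are compact on each block, and
the matrix units, hence all compact block operators, lie in the closed algebra. Therefore the
concrete algebra is the unitization of the sum of the compacts (`unitizationHom_bijective`), which
also gives the split extension.

Universality needs no abstract construction: for `c`, `d` in `B`, the algebra generated by `(a, c)`
and `(b, d)` in the product projects bijectively onto the concrete algebra by rigidity, so it is the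
graph of the required homomorphism. -/

theorem continuous_starAlgHom {A B : Type*} [CStarAlgebra A] [CStarAlgebra B]
    (φ : A →⋆ₐ[ℂ] B) : Continuous φ :=
  AddMonoidHomClass.continuous_of_bound φ 1
    (by simpa only [one_mul] using NonUnitalStarAlgHom.norm_apply_le φ)

/-- Clear for polynomials, and a continuous `f` is a uniform limit of polynomials. Allowing `a' ≠ a`
matters: it is applied with `a'` a multiple of `a` and with `a'` a scalar. -/
theorem cfc_mul_eq_mul_cfc {A : Type*} [CStarAlgebra A] {a a' x : A} (ha : IsSelfAdjoint a)
    (ha' : IsSelfAdjoint a') (h : a * x = x * a') {f : ℝ → ℝ} (hf : Continuous f) :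
    cfc f a * x = x * cfc f a' := by
  have hpoly : ∀ p : Polynomial ℝ, Polynomial.aeval a p * x = x * Polynomial.aeval a' p := by
    intro p
    induction p using Polynomial.induction_on' with
    | add p r hp hr => simp only [map_add, add_mul, mul_add, hp, hr]
    | monomial n c =>
      have hs : SemiconjBy x a' a := h.symm
      have := (hs.pow_right n).eq
      simp only [Polynomial.aeval_monomial, ← Algebra.smul_def, mul_smul_comm, smul_mul_assoc, this]
  have near : ∀ ε > 0, ‖cfc f a * x - x * cfc f a'‖ ≤ ε * (2 * ‖x‖) := by
    intro ε hε
    -- One interval containing both spectra, so that a single polynomial serves `a` and `a'`.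
    obtain ⟨p, hp⟩ := exists_polynomial_near_of_continuousOn (-(max ‖a‖ ‖a'‖)) (max ‖a‖ ‖a'‖) f
      hf.continuousOn ε hε
    have key : ∀ y : A, IsSelfAdjoint y → ‖y‖ ≤ max ‖a‖ ‖a'‖ →
        ‖cfc f y - Polynomial.aeval y p‖ ≤ ε := by
      intro y hy hyn
      rw [← cfc_polynomial p y hy, ← cfc_sub f (fun t => p.eval t) y hf.continuousOn
        p.continuous.continuousOn]
      refine norm_cfc_le hε.le fun t ht => ?_
      have htn : ‖t‖ ≤ max ‖a‖ ‖a'‖ := by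
        cases subsingleton_or_nontrivial A
        · simp [spectrum.of_subsingleton] at ht
        · exact (spectrum.norm_le_norm_of_mem ht).trans hyn
      rw [Real.norm_eq_abs] at htn ⊢
      rw [abs_sub_comm]
      exact (hp t (abs_le.1 htn)).le
    have e : cfc f a * x - x * cfc f a' =
        (cfc f a - Polynomial.aeval a p) * x - x * (cfc f a' - Polynomial.aeval a' p) := by
      rw [sub_mul, mul_sub, hpoly]; abel
    rw [e]
    have h1 := key a ha (le_max_left _ _)
    have h2 := key a' ha' (le_max_right _ _)
    calc _ ≤ ‖cfc f a - Polynomial.aeval a p‖ * ‖x‖ + ‖x‖ * ‖cfc f a' - Polynomial.aeval a' p‖ :=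
          (norm_sub_le _ _).trans (add_le_add (norm_mul_le _ _) (norm_mul_le _ _))
      _ ≤ ε * ‖x‖ + ‖x‖ * ε := by gcongr
      _ = _ := by ring
  have : ‖cfc f a * x - x * cfc f a'‖ ≤ 0 := by
    have ht : Filter.Tendsto (fun ε : ℝ => ε * (2 * ‖x‖)) (nhdsWithin 0 (Set.Ioi 0))
        (nhds (0 * (2 * ‖x‖))) := (Continuous.tendsto (by fun_prop) 0).mono_left nhdsWithin_le_nhds
    rw [zero_mul] at ht
    exact ge_of_tendsto ht (Filter.eventually_of_mem self_mem_nhdsWithin near)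
  exact sub_eq_zero.1 (norm_le_zero_iff.1 this)

theorem pow_mul_prod_eq_cfc {A : Type*} [CStarAlgebra A] {a : A} (ha : IsSelfAdjoint a)
    (k l : ℕ) (c : ℕ → ℝ) :
    a ^ k * ((List.range l).map fun m : ℕ => 1 - (c m : ℂ) • a).prod =
      cfc (fun x : ℝ => x ^ k * ∏ m ∈ Finset.range l, (1 - c m * x)) a := by
  induction l with
  | zero => simp [cfc_pow_id (R := ℝ) a k]
  | succ l ih =>
    simp only [List.range_succ, List.map_append, List.prod_append, List.map_cons, List.map_nil,
      List.prod_cons, List.prod_nil, mul_one, Finset.prod_range_succ, ← mul_assoc]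
    rw [ih, cfc_mul (fun x : ℝ => x ^ k * ∏ m ∈ Finset.range l, (1 - c m * x))
      (fun x => 1 - c l * x) a (by fun_prop) (by fun_prop),
      cfc_sub (fun _ => 1) (fun x => c l * x) a (by fun_prop) (by fun_prop),
      cfc_const_one ℝ a, cfc_const_mul_id (c l) a, Complex.coe_smul]

/-- The relations are identities between *-polynomials, so they can be tested after maps that
jointly separate points. It serves both closed subalgebras and subalgebras of a product. -/
theorem Relations.of_jointly_injective {A B C : Type*} [CStarAlgebra A] [CStarAlgebra B]
    [CStarAlgebra C] {q : ℝ} {k l : ℕ} (φ : A →⋆ₐ[ℂ] B) (ψ : A →⋆ₐ[ℂ] C)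
    (hinj : ∀ x y, φ x = φ y → ψ x = ψ y → x = y) {a b : A}
    (h1 : Relations q k l (φ a) (φ b)) (h2 : Relations q k l (ψ a) (ψ b)) :
    Relations q k l a b where
  star_a := hinj _ _ (by rw [map_star, h1.star_a]) (by rw [map_star, h2.star_a])
  a_mul_b := hinj _ _ (by simpa using h1.a_mul_b) (by simpa using h2.a_mul_b)
  b_mul_star_b := by
    refine hinj _ _ ?_ ?_
    · rw [map_mul, map_star]
      simpa [map_list_prod, Function.comp_def] using h1.b_mul_star_b
    · rw [map_mul, map_star]
      simpa [map_list_prod, Function.comp_def] using h2.b_mul_star_b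
  star_b_mul_b := by
    refine hinj _ _ ?_ ?_
    · rw [map_mul, map_star]
      simpa [map_list_prod, Function.comp_def] using h1.star_b_mul_b
    · rw [map_mul, map_star]
      simpa [map_list_prod, Function.comp_def] using h2.star_b_mul_b

/-- The elements of a C*-algebra that generate a closed *-subalgebra also generate it
when regarded as a C*-algebra of its own. -/
theorem topologicalClosure_adjoin_coe_preimage {A : Type*} [CStarAlgebra A] (s : Set A)
    (t : Set (StarAlgebra.adjoin ℂ s).topologicalClosure) (h : Subtype.val '' t = s) :
    (StarAlgebra.adjoin ℂ t).topologicalClosure = ⊤ := by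
  rw [eq_top_iff]
  rintro x -
  have hmap : Subtype.val '' (StarAlgebra.adjoin ℂ t : Set (StarAlgebra.adjoin ℂ s).topologicalClosure) = (StarAlgebra.adjoin ℂ s : Set A) := by
    have := StarAlgHom.map_adjoin ((StarAlgebra.adjoin ℂ s).topologicalClosure.subtype) t
    have h2 : ((StarAlgebra.adjoin ℂ s).topologicalClosure.subtype) '' t = s := h
    rw [h2] at this
    exact congrArg (fun S : StarSubalgebra ℂ A => (S : Set A)) this
  have hx : (x : A) ∈ closure (StarAlgebra.adjoin ℂ s : Set A) := x.2
  rw [← hmap] at hx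
  exact closure_subtype.2 hx

end WPq

/-! ## The spectrum of `a` and its spectral projections -/

namespace WPq

open Filter Topology

/-- The polynomial `h` with `b⋆ b = h(a)`. -/
noncomputable def hPoly (q : ℝ) (k l : ℕ) (x : ℝ) : ℝ :=
  x ^ k * ∏ m ∈ Finset.range l, (1 - q ^ (-(2 * ((m : ℤ) + 1))) * x)

/-- The polynomial `g` with `b b⋆ = g(a)`. -/
noncomputable def gPoly (q : ℝ) (k l : ℕ) (x : ℝ) : ℝ :=
  q ^ (2 * k * l) * (x ^ k * ∏ m ∈ Finset.range l, (1 - q ^ (2 * m) * x))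

@[fun_prop]
theorem continuous_hPoly (q : ℝ) (k l : ℕ) : Continuous (hPoly q k l) := by
  unfold hPoly; fun_prop

@[fun_prop]
theorem continuous_gPoly (q : ℝ) (k l : ℕ) : Continuous (gPoly q k l) := by
  unfold gPoly; fun_prop

/-- A tent function that is `1` at `q^{2n}` and vanishes at `0` and at all other even powers
of `q`. -/
noncomputable def bump (q : ℝ) (n : ℕ) (x : ℝ) : ℝ :=
  max 0 (1 - |x / q ^ (2 * n) - 1| / (1 - q ^ 2))

@[fun_prop]
theorem continuous_bump (q : ℝ) (n : ℕ) : Continuous (bump q n) := by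
  unfold bump; fun_prop

section bump

variable {q : ℝ} (hq : q ∈ Set.Ioo (0 : ℝ) 1)
include hq

theorem one_sub_sq_pos : 0 < 1 - q ^ 2 := by nlinarith [hq.1, hq.2]

theorem bump_self (n : ℕ) : bump q n (q ^ (2 * n)) = 1 := by
  have := hq.1.ne'
  simp [bump, this]

theorem bump_zero (n : ℕ) : bump q n 0 = 0 := by
  have h := one_sub_sq_pos hq
  have : 1 ≤ 1 / (1 - q ^ 2) := by
    rw [le_div_iff₀ h]; nlinarith [sq_nonneg q]
  simpa [bump] using this

/-- The relative distance from `q^{2n}` to any other even power of `q` is at least `1 - q²`, the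
half-width of the tent, with equality at the next smaller one. -/
theorem bump_ne {m n : ℕ} (hmn : m ≠ n) : bump q n (q ^ (2 * m)) = 0 := by
  have h := one_sub_sq_pos hq
  have h0 := hq.1
  have hp : ∀ d : ℕ, q ^ (2 * (d + 1)) ≤ q ^ 2 := fun d =>
    pow_le_pow_of_le_one hq.1.le hq.2.le (by omega)
  have key : 1 - q ^ 2 ≤ |q ^ (2 * m) / q ^ (2 * n) - 1| := by
    rcases lt_or_gt_of_ne hmn with hlt | hlt
    · obtain ⟨d, rfl⟩ := Nat.exists_eq_add_of_lt hlt
      refine le_trans ?_ (le_abs_self _)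
      have e : q ^ (2 * m) / q ^ (2 * (m + d + 1)) = 1 / q ^ (2 * (d + 1)) := by
        rw [show 2 * (m + d + 1) = 2 * m + 2 * (d + 1) by ring, pow_add]
        field_simp
      rw [e]
      have : (1 : ℝ) ≤ 1 / q ^ (2 * (d + 1)) * q ^ 2 := by
        rw [one_div_mul_eq_div, le_div_iff₀ (by positivity), one_mul]; exact hp d
      have h2 : 1 / q ^ (2 * (d + 1)) * (1 - q ^ 2) ≥ 1 * (1 - q ^ 2) := by
        gcongr
        rw [le_div_iff₀ (by positivity), one_mul]
        exact pow_le_one₀ hq.1.le hq.2.le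
      linarith
    · obtain ⟨d, rfl⟩ := Nat.exists_eq_add_of_lt hlt
      rw [abs_sub_comm]
      refine le_trans ?_ (le_abs_self _)
      have e : q ^ (2 * (n + d + 1)) / q ^ (2 * n) = q ^ (2 * (d + 1)) := by
        rw [show 2 * (n + d + 1) = 2 * n + 2 * (d + 1) by ring, pow_add]
        field_simp
      rw [e]
      linarith [hp d]
  have : 1 ≤ |q ^ (2 * m) / q ^ (2 * n) - 1| / (1 - q ^ 2) := by
    rwa [le_div_iff₀ h, one_mul]
  simpa [bump] using this

theorem bump_scale (n l : ℕ) (x : ℝ) :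
    bump q n ((q ^ (2 * l))⁻¹ * x) = bump q (n + l) x := by
  have h0 := hq.1.ne'
  have : (q ^ (2 * l))⁻¹ * x / q ^ (2 * n) = x / q ^ (2 * (n + l)) := by
    rw [mul_add, pow_add]; field_simp
  rw [bump, bump, this]

end bump

variable {q : ℝ} {k l : ℕ} {A : Type*} [CStarAlgebra A] {a b : A}

namespace Relations

theorem isSelfAdjoint (R : Relations q k l a b) : IsSelfAdjoint a := R.star_a

theorem star_mul_eq_cfc (R : Relations q k l a b) : star b * b = cfc (hPoly q k l) a := by
  rw [R.star_b_mul_b]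
  convert pow_mul_prod_eq_cfc R.isSelfAdjoint k l (fun m => q ^ (-(2 * ((m : ℤ) + 1)))) using 6
  · push_cast; rfl
  · rfl

theorem mul_star_eq_cfc (R : Relations q k l a b) : b * star b = cfc (gPoly q k l) a := by
  rw [R.b_mul_star_b]
  have := pow_mul_prod_eq_cfc R.isSelfAdjoint k l (fun m => q ^ (2 * m))
  push_cast at this
  rw [this]
  unfold gPoly
  rw [cfc_const_mul _ _ a (by fun_prop), ← Complex.coe_smul]
  push_cast; rfl

theorem mul_eq (R : Relations q k l a b) : a * b = b * ((q ^ (2 * l))⁻¹ • a) := by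
  rw [R.a_mul_b, mul_smul_comm, ← Complex.coe_smul, zpow_neg]
  push_cast
  norm_cast

theorem cfc_mul_b (R : Relations q k l a b) {f : ℝ → ℝ} (hf : Continuous f) :
    cfc f a * b = b * cfc (fun x => f ((q ^ (2 * l))⁻¹ * x)) a := by
  have hs : IsSelfAdjoint ((q ^ (2 * l))⁻¹ • a) := (IsSelfAdjoint.all _).smul R.isSelfAdjoint
  rw [cfc_mul_eq_mul_cfc R.isSelfAdjoint hs R.mul_eq hf]
  congr 1
  exact (cfc_comp_smul ((q ^ (2 * l))⁻¹) f a (by fun_prop) R.isSelfAdjoint).symm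

/-- With `f` the distance to the spectrum, `f(a) = 0`, hence `0 = b⋆ f(a) b = h(a) f(q^{-2l} a)`. By
spectral mapping `h(x) f(q^{-2l} x) = 0` for each spectral point `x`. -/
theorem scale_mem_spectrum (R : Relations q k l a b) {x : ℝ} (hx : x ∈ spectrum ℝ a)
    (hh : hPoly q k l x ≠ 0) : (q ^ (2 * l))⁻¹ * x ∈ spectrum ℝ a := by
  by_contra hn
  have hne : (spectrum ℝ a).Nonempty := ⟨x, hx⟩
  have hcl : IsClosed (spectrum ℝ a) := spectrum.isClosed a
  have hf : Continuous fun t => Metric.infDist t (spectrum ℝ a) := Metric.continuous_infDist_pt _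
  have h0 : cfc (fun t => Metric.infDist t (spectrum ℝ a)) a = 0 := by
    rw [← cfc_const_zero ℝ a]
    exact cfc_congr fun t ht => Metric.infDist_zero_of_mem ht
  have h1 := R.cfc_mul_b hf
  rw [h0, zero_mul] at h1
  have hf' : Continuous fun t => Metric.infDist ((q ^ (2 * l))⁻¹ * t) (spectrum ℝ a) := by
    fun_prop
  have h2 : cfc (fun t => hPoly q k l t * Metric.infDist ((q ^ (2 * l))⁻¹ * t) (spectrum ℝ a)) a
      = 0 := by
    rw [cfc_mul (hPoly q k l) _ a (by fun_prop) hf'.continuousOn, ← R.star_mul_eq_cfc, mul_assoc,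
      ← h1, mul_zero]
  have hc : ContinuousOn (fun t => hPoly q k l t *
      Metric.infDist ((q ^ (2 * l))⁻¹ * t) (spectrum ℝ a)) (spectrum ℝ a) :=
    ((continuous_hPoly q k l).mul hf').continuousOn
  have h3 := cfc_map_spectrum (R := ℝ) _ a R.isSelfAdjoint hc
  rw [h2] at h3
  have h4 := h3.symm ▸ Set.mem_image_of_mem _ hx
  have : Nontrivial A := by
    by_contra h
    rw [not_nontrivial_iff_subsingleton] at h
    simp [spectrum.of_subsingleton] at hx
  rw [spectrum.zero_eq, Set.mem_singleton_iff, mul_eq_zero] at h4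
  exact hn ((hcl.mem_iff_infDist_zero hne).2 (h4.resolve_left hh))

theorem mem_spectrum (R : Relations q k l a b) (hq : q ∈ Set.Ioo (0 : ℝ) 1) (hl : 0 < l) {x : ℝ}
    (hx : x ∈ spectrum ℝ a) : x = 0 ∨ ∃ (s : Fin l) (p : ℕ), x = q ^ (2 * (l * p + (s + 1))) := by
  have hq0 := hq.1
  by_cases hx0 : x = 0
  · exact Or.inl hx0
  right
  have hQ : 0 < q ^ (2 * l) := by positivity
  -- Otherwise all the scaled points lie in the spectrum, and they eventually exceed `‖a‖`.
  have : ∃ j : ℕ, hPoly q k l (((q ^ (2 * l))⁻¹) ^ j * x) = 0 := by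
    by_contra! hno
    have hall : ∀ j : ℕ, ((q ^ (2 * l))⁻¹) ^ j * x ∈ spectrum ℝ a := by
      intro j
      induction j with
      | zero => simpa using hx
      | succ j ih =>
        have := R.scale_mem_spectrum ih (hno j)
        rwa [← mul_assoc, ← pow_succ'] at this
    have : Nontrivial A := by
      by_contra h
      rw [not_nontrivial_iff_subsingleton] at h
      simp [spectrum.of_subsingleton] at hx
    have hgt : 1 < (q ^ (2 * l))⁻¹ :=
      (one_lt_inv₀ hQ).2 (pow_lt_one₀ hq.1.le hq.2 (by omega))
    obtain ⟨j, hj⟩ := pow_unbounded_of_one_lt (‖a‖ / |x|) hgt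
    have h1 := spectrum.norm_le_norm_of_mem (hall j)
    rw [div_lt_iff₀ (abs_pos.2 hx0)] at hj
    rw [norm_mul, Real.norm_eq_abs, Real.norm_eq_abs, abs_of_pos (by positivity)] at h1
    linarith
  obtain ⟨j, hj⟩ := this
  have hne : ((q ^ (2 * l))⁻¹) ^ j * x ≠ 0 := mul_ne_zero (by positivity) hx0
  rw [hPoly, mul_eq_zero] at hj
  obtain ⟨m, hm, hm0⟩ := Finset.prod_eq_zero_iff.1 (hj.resolve_left (pow_ne_zero _ hne))
  refine ⟨⟨m, Finset.mem_range.1 hm⟩, j, ?_⟩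
  have e : q ^ (-(2 * ((m : ℤ) + 1))) = (q ^ (2 * (m + 1)))⁻¹ := by
    rw [zpow_neg]; norm_cast
  rw [e] at hm0
  have e2 : q ^ (2 * (l * j + (m + 1))) = (q ^ (2 * l)) ^ j * q ^ (2 * (m + 1)) := by
    rw [← pow_mul, ← pow_add]; ring_nf
  rw [e2]
  rw [inv_pow] at hm0
  have hQj : 0 < (q ^ (2 * l)) ^ j := by positivity
  field_simp at hm0
  linarith

end Relations

/-- The spectral projection of `a` at the point `q^{2n}`. -/
noncomputable def proj (q : ℝ) (a : A) (n : ℕ) : A := cfc (bump q n) a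

theorem star_proj (n : ℕ) : star (proj q a n) = proj q a n :=
  (cfc_predicate (p := IsSelfAdjoint) (bump q n) a).star_eq

theorem hPoly_small (hq : q ∈ Set.Ioo (0 : ℝ) 1) (s : Fin l) :
    hPoly q k l (q ^ (2 * (s.1 + 1))) = 0 := by
  have h0 := hq.1.ne'
  rw [hPoly, mul_eq_zero]
  right
  refine Finset.prod_eq_zero (Finset.mem_range.2 s.2) ?_
  have e : q ^ (-(2 * ((s.1 : ℤ) + 1))) = (q ^ (2 * (s.1 + 1)))⁻¹ := by
    rw [zpow_neg]; norm_cast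
  rw [e, inv_mul_cancel₀ (pow_ne_zero _ h0), sub_self]

namespace Relations

variable (R : Relations q k l a b) (hq : q ∈ Set.Ioo (0 : ℝ) 1) (hl : 0 < l)
include R hq hl

theorem cfc_mul_proj {f : ℝ → ℝ} (hf : Continuous f) (n : ℕ) :
    cfc f a * proj q a n = f (q ^ (2 * n)) • proj q a n := by
  rw [proj, ← cfc_mul f _ a hf.continuousOn (by fun_prop), ← cfc_const_mul _ _ a (by fun_prop)]
  refine cfc_congr fun x hx => ?_
  rcases R.mem_spectrum hq hl hx with rfl | ⟨s, p, rfl⟩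
  · simp [bump_zero hq]
  · by_cases h : l * p + (s + 1) = n
    · subst h; rfl
    · simp [bump_ne hq h]

theorem proj_mul_proj (m n : ℕ) :
    proj q a m * proj q a n = if m = n then proj q a n else 0 := by
  rw [proj, R.cfc_mul_proj hq hl (by fun_prop)]
  split_ifs with h
  · subst h; rw [bump_self hq, one_smul]
  · rw [bump_ne hq (Ne.symm h), zero_smul]

omit hl in
theorem proj_mul_b (n : ℕ) : proj q a n * b = b * proj q a (n + l) := by
  rw [proj, R.cfc_mul_b (by fun_prop), proj]
  simp only [bump_scale hq]

omit hl in
theorem star_b_mul_proj (n : ℕ) : star b * proj q a n = proj q a (n + l) * star b := by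
  have := congrArg star (R.proj_mul_b hq n)
  simpa [star_proj] using this

/-- `(bP)⋆(bP) = P h(a) P`, and `h` vanishes at the first point of each sequence. -/
theorem b_mul_proj_eq_zero (s : Fin l) : b * proj q a (s + 1) = 0 := by
  rw [← CStarRing.star_mul_self_eq_zero_iff, star_mul, mul_assoc, ← mul_assoc (star b),
    R.star_mul_eq_cfc, R.cfc_mul_proj hq hl (by fun_prop), hPoly_small hq, zero_smul, mul_zero]

theorem a_mul_proj (n : ℕ) : a * proj q a n = (q ^ (2 * n)) • proj q a n := by
  have := R.cfc_mul_proj hq hl continuous_id n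
  rwa [cfc_id ℝ a R.isSelfAdjoint] at this

end Relations
end WPq

/-! ## Elements vanishing at infinity -/

namespace WPq

open Filter Topology

theorem mem_of_generate {A : Type*} [CStarAlgebra A] {a b : A}
    (h : (StarAlgebra.adjoin ℂ ({a, b} : Set A)).topologicalClosure = ⊤) (S : StarSubalgebra ℂ A)
    (hS : IsClosed (S : Set A)) (ha : a ∈ S) (hb : b ∈ S) (x : A) : x ∈ S := by
  have h1 : (StarAlgebra.adjoin ℂ ({a, b} : Set A)).topologicalClosure ≤ S :=
    StarSubalgebra.topologicalClosure_minimal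
      (StarAlgebra.adjoin_le (by rintro y (rfl | rfl) <;> assumption)) hS
  exact h1 (h ▸ StarSubalgebra.mem_top)

/-- The elements `x` with `x g_N → 0`. -/
def vanishing {A : Type*} [CStarAlgebra A] (g : ℕ → A) : Submodule ℂ A where
  carrier := {x | Tendsto (fun N => x * g N) atTop (𝓝 0)}
  add_mem' := fun hx hy => by simpa [add_mul] using Tendsto.add hx hy
  zero_mem' := by simp
  smul_mem' := fun c x hx => by simpa using Tendsto.const_smul hx c

section vanishing

variable {A : Type*} [CStarAlgebra A] {g : ℕ → A}

theorem mem_vanishing {x : A} : x ∈ vanishing g ↔ Tendsto (fun N => x * g N) atTop (𝓝 0) := Iff.rfl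

theorem mul_mem_vanishing (y : A) {x : A} (hx : x ∈ vanishing g) : y * x ∈ vanishing g := by
  rw [mem_vanishing] at *
  simpa [mul_assoc] using hx.const_mul y

theorem isClosed_vanishing (hg : ∀ N, ‖g N‖ ≤ 1) : IsClosed (vanishing g : Set A) := by
  refine isClosed_of_closure_subset fun x hx => ?_
  change Tendsto (fun N => x * g N) atTop (𝓝 0)
  rw [Metric.tendsto_atTop]
  intro ε hε
  obtain ⟨y, hy, hxy⟩ := Metric.mem_closure_iff.1 hx (ε / 2) (by positivity)
  obtain ⟨N, hN⟩ := Metric.tendsto_atTop.1 (mem_vanishing.1 hy) (ε / 2) (by positivity)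
  refine ⟨N, fun n hn => ?_⟩
  have h1 := hN n hn
  rw [dist_zero_right] at h1 ⊢
  rw [dist_eq_norm] at hxy
  have e : x * g n = (x - y) * g n + y * g n := by rw [sub_mul]; abel
  have h2 : ‖(x - y) * g n‖ ≤ ‖x - y‖ :=
    (norm_mul_le _ _).trans (mul_le_of_le_one_right (norm_nonneg _) (hg n))
  rw [e]
  linarith [norm_add_le ((x - y) * g n) (y * g n)]

/-- `‖x g‖² = ‖g⋆ x⋆ x g‖ ≤ ‖x⋆ x g‖` for a contraction `g`. -/
theorem mem_vanishing_of_star_mul_self (hg : ∀ N, ‖g N‖ ≤ 1) {x : A}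
    (hx : star x * x ∈ vanishing g) : x ∈ vanishing g := by
  rw [mem_vanishing] at *
  rw [tendsto_zero_iff_norm_tendsto_zero] at hx ⊢
  have h1 : Tendsto (fun N => ‖x * g N‖ ^ 2) atTop (𝓝 0) := by
    refine squeeze_zero (fun _ => by positivity) (fun N => ?_) hx
    rw [sq, ← CStarRing.norm_star_mul_self, star_mul, mul_assoc, ← mul_assoc (star x)]
    refine (norm_mul_le _ _).trans (mul_le_of_le_one_left (norm_nonneg _) ?_)
    rw [norm_star]; exact hg N
  have := h1.sqrt
  simpa using this

/-- If `ω` is a unital character that vanishes on generators `a`, `b` on which `x ↦ x g_N` and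
`x ↦ g_N⋆ x` tend to zero, then they tend to zero on `x - ω(x)` for every `x`. -/
theorem sub_character_mem_vanishing (hg : ∀ N, ‖g N‖ ≤ 1) {a b : A}
    (h : (StarAlgebra.adjoin ℂ ({a, b} : Set A)).topologicalClosure = ⊤)
    (ha : a ∈ vanishing g) (ha' : star a ∈ vanishing g)
    (hb : b ∈ vanishing g) (hb' : star b ∈ vanishing g)
    (ω : A →⋆ₐ[ℂ] ℂ) (hωa : ω a = 0) (hωb : ω b = 0) (x : A) :
    x - algebraMap ℂ A (ω x) ∈ vanishing g ∧ star (x - algebraMap ℂ A (ω x)) ∈ vanishing g := by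
  -- Imposing the condition on the adjoint as well makes `S` a *-subalgebra. Products are handled by
  -- `xy - ω(xy) = x(y - ω(y)) + ω(y)(x - ω(x))`, as `vanishing g` is a left ideal.
  let S : StarSubalgebra ℂ A :=
    { carrier := {x | x - algebraMap ℂ A (ω x) ∈ vanishing g ∧
        star (x - algebraMap ℂ A (ω x)) ∈ vanishing g}
      mul_mem' := by
        rintro x y ⟨hx, hx'⟩ ⟨hy, hy'⟩
        constructor
        · have e : x * y - algebraMap ℂ A (ω (x * y)) =
              x * (y - algebraMap ℂ A (ω y)) + (ω y) • (x - algebraMap ℂ A (ω x)) := by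
            simp only [map_mul, Algebra.algebraMap_eq_smul_one, mul_sub, smul_sub,
              mul_smul_comm, mul_one, smul_smul]
            rw [mul_comm (ω y)]; abel
          rw [e]
          exact add_mem (mul_mem_vanishing x hy)
            (Submodule.smul_mem _ _ hx)
        · have e : star (x * y - algebraMap ℂ A (ω (x * y))) =
              star y * star (x - algebraMap ℂ A (ω x)) +
                star (ω x) • star (y - algebraMap ℂ A (ω y)) := by
            rw [← star_mul, ← star_smul, ← star_add]
            congr 1
            simp only [map_mul, Algebra.algebraMap_eq_smul_one, sub_mul, smul_sub, smul_mul_assoc,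
              one_mul, smul_smul]
            abel
          rw [e]
          exact add_mem (mul_mem_vanishing _ hx') (Submodule.smul_mem _ _ hy')
      add_mem' := by
        rintro x y ⟨hx, hx'⟩ ⟨hy, hy'⟩
        have e : x + y - algebraMap ℂ A (ω (x + y)) =
            (x - algebraMap ℂ A (ω x)) + (y - algebraMap ℂ A (ω y)) := by
          rw [map_add, map_add]; abel
        constructor
        · rw [e]; exact add_mem hx hy
        · rw [e, star_add]; exact add_mem hx' hy'
      algebraMap_mem' := by
        intro r
        have : algebraMap ℂ A r - algebraMap ℂ A (ω (algebraMap ℂ A r)) = 0 := by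
          rw [AlgHomClass.commutes, sub_eq_zero]; rfl
        constructor
        · rw [this]; exact zero_mem _
        · rw [this, star_zero]; exact zero_mem _
      star_mem' := by
        rintro x ⟨hx, hx'⟩
        have e : star x - algebraMap ℂ A (ω (star x)) = star (x - algebraMap ℂ A (ω x)) := by
          rw [map_star, star_sub, algebraMap_star_comm]
        constructor
        · rw [e]; exact hx'
        · rw [e, star_star]; exact hx }
  have hω : Continuous ω := continuous_starAlgHom ω
  have hc : Continuous fun x : A => x - algebraMap ℂ A (ω x) :=
    continuous_id.sub ((continuous_algebraMap ℂ A).comp hω)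
  have hS : IsClosed (S : Set A) :=
    ((isClosed_vanishing hg).preimage hc).inter ((isClosed_vanishing hg).preimage hc.star)
  refine mem_of_generate h S hS ?_ ?_ x
  · change _ ∧ _
    rw [hωa, map_zero, sub_zero]; exact ⟨ha, ha'⟩
  · change _ ∧ _
    rw [hωb, map_zero, sub_zero]; exact ⟨hb, hb'⟩

end vanishing

/-- `1 - ∑ bump` over the first `N` points in each of the `l` sequences `q^{2(lp+s)}`. -/
noncomputable def tail (q : ℝ) (l N : ℕ) (x : ℝ) : ℝ :=
  1 - ∑ s : Fin l, ∑ p ∈ Finset.range N, bump q (l * p + (s + 1)) x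

@[fun_prop]
theorem continuous_tail (q : ℝ) (l N : ℕ) : Continuous (tail q l N) := by
  unfold tail; fun_prop

theorem index_injective {l : ℕ} {s s' : Fin l} {p p' : ℕ}
    (h : l * p + (s + 1) = l * p' + (s' + 1)) : s = s' ∧ p = p' := by
  have h1 : l * p + s.1 = l * p' + s'.1 := by omega
  have hl : 0 < l := s.pos
  have hp : p = p' := by
    have := congrArg (· / l) h1
    simpa [Nat.mul_add_div hl, Nat.div_eq_of_lt s.2, Nat.div_eq_of_lt s'.2] using this
  subst hp
  exact ⟨Fin.ext (by omega), rfl⟩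

theorem tail_zero {q : ℝ} (hq : q ∈ Set.Ioo (0 : ℝ) 1) (l N : ℕ) : tail q l N 0 = 1 := by
  simp [tail, bump_zero hq]

theorem tail_point {q : ℝ} (hq : q ∈ Set.Ioo (0 : ℝ) 1) {l : ℕ} (N : ℕ) (s : Fin l) (p : ℕ) :
    tail q l N (q ^ (2 * (l * p + (s + 1)))) = if p < N then 0 else 1 := by
  have : ∑ s' : Fin l, ∑ p' ∈ Finset.range N, bump q (l * p' + (s' + 1))
      (q ^ (2 * (l * p + (s + 1)))) = if p < N then 1 else 0 := by
    rw [Finset.sum_eq_single s]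
    · by_cases h : p < N
      · rw [Finset.sum_eq_single p, bump_self hq, if_pos h]
        · intro p' _ hne
          exact bump_ne hq fun h' => hne (index_injective h').2.symm
        · intro h'; exact absurd (Finset.mem_range.2 h) h'
      · rw [if_neg h]
        refine Finset.sum_eq_zero fun p' hp' => bump_ne hq fun h' => h ?_
        rw [(index_injective h').2]; exact Finset.mem_range.1 hp'
    · intro s' _ hne
      exact Finset.sum_eq_zero fun p' _ => bump_ne hq fun h' => hne (index_injective h').1.symm
    · simp
  rw [tail, this]
  split_ifs <;> simp

variable {q : ℝ} {k l : ℕ} {A : Type*} [CStarAlgebra A] {a b : A}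

/-- The spectral projection of `a` complementary to the first `N` points of each sequence. -/
noncomputable def cut (q : ℝ) (l : ℕ) (a : A) (N : ℕ) : A := cfc (tail q l N) a

theorem star_cut (N : ℕ) : star (cut q l a N) = cut q l a N :=
  (cfc_predicate (p := IsSelfAdjoint) _ a).star_eq

namespace Relations

variable (R : Relations q k l a b) (hq : q ∈ Set.Ioo (0 : ℝ) 1) (hl : 0 < l)
include R

theorem cut_eq (N : ℕ) :
    cut q l a N = 1 - ∑ s : Fin l, ∑ p ∈ Finset.range N, proj q a (l * p + (s + 1)) := by
  have hs := R.isSelfAdjoint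
  have e : (fun x => ∑ s : Fin l, ∑ p ∈ Finset.range N, bump q (l * p + (s + 1)) x) =
      ∑ s : Fin l, ∑ p ∈ Finset.range N, bump q (l * p + (s + 1)) := by
    ext x; simp
  have hc : ∀ s : Fin l, Continuous (∑ p ∈ Finset.range N, bump q (l * p + (s + 1))) := by
    intro s
    rw [Finset.sum_fn]; fun_prop
  unfold cut tail
  rw [cfc_sub _ _ a (by fun_prop) (by fun_prop), cfc_const_one ℝ a, e,
    cfc_sum_univ _ _ (fun s => (hc s).continuousOn)]
  congr 1
  refine Finset.sum_congr rfl fun s _ => ?_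
  exact cfc_sum (R := ℝ) (fun p => bump q (l * p + (s + 1))) a (Finset.range N) (by fun_prop)

include hq hl

theorem norm_cut_le (N : ℕ) : ‖cut q l a N‖ ≤ 1 := by
  refine norm_cfc_le zero_le_one fun x hx => ?_
  rcases R.mem_spectrum hq hl hx with rfl | ⟨s, p, rfl⟩
  · simp [tail_zero hq]
  · rw [tail_point hq]; split_ifs <;> simp

/-- The nonzero spectral points surviving the cut have `p ≥ N`, so they are at most `q^{2N}`. -/
theorem a_mem_vanishing : a ∈ vanishing (cut q l a) := by
  rw [mem_vanishing]
  have hb : ∀ N, ‖a * cut q l a N‖ ≤ (q ^ 2) ^ N := by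
    intro N
    have e : a * cut q l a N = cfc (fun x => x * tail q l N x) a := by
      rw [cfc_mul (fun x : ℝ => x) _ a (by fun_prop) (by fun_prop),
        cfc_id' ℝ a R.isSelfAdjoint, cut]
    have h0 := hq.1
    rw [e]
    refine norm_cfc_le (by positivity) fun x hx => ?_
    rcases R.mem_spectrum hq hl hx with rfl | ⟨s, p, rfl⟩
    · simp; positivity
    · rw [tail_point hq]
      split_ifs with h
      · simp; positivity
      · rw [mul_one, Real.norm_eq_abs, abs_of_pos (by positivity), ← pow_mul]
        refine pow_le_pow_of_le_one hq.1.le hq.2.le ?_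
        have : N ≤ l * p := (not_lt.1 h).trans (Nat.le_mul_of_pos_left p hl)
        omega
  refine squeeze_zero_norm hb (tendsto_pow_atTop_nhds_zero_of_lt_one (sq_nonneg q) ?_)
  linarith [one_sub_sq_pos hq]

omit hq hl in
-- As `k > 0`, a factor `a` splits off on the right, and the vanishing elements form a left ideal.
-- This is applied to `b⋆ b` and `b b⋆`.
theorem cfc_mem_vanishing (hk : 0 < k) {c : ℝ} {f : ℝ → ℝ} (hf : Continuous f)
    (ha : a ∈ vanishing (cut q l a)) :
    cfc (fun x => c * (x ^ k * f x)) a ∈ vanishing (cut q l a) := by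
  obtain ⟨j, rfl⟩ := Nat.exists_eq_succ_of_ne_zero hk.ne'
  have e : (fun x : ℝ => c * (x ^ (j + 1) * f x)) = fun x => (c * x ^ j * f x) * x := by
    ext x; ring
  rw [Nat.succ_eq_add_one, e, cfc_mul (fun x : ℝ => c * x ^ j * f x) _ a (by fun_prop) (by fun_prop),
    cfc_id' ℝ a R.isSelfAdjoint]
  exact mul_mem_vanishing _ ha

theorem b_mem_vanishing (hk : 0 < k) : b ∈ vanishing (cut q l a) := by
  refine mem_vanishing_of_star_mul_self (R.norm_cut_le hq hl) ?_
  rw [R.star_mul_eq_cfc]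
  have := R.cfc_mem_vanishing hk (c := 1)
    (f := fun x => ∏ m ∈ Finset.range l, (1 - q ^ (-(2 * ((m : ℤ) + 1))) * x)) (by fun_prop)
    (R.a_mem_vanishing hq hl)
  unfold hPoly
  simpa only [one_mul] using this

theorem star_b_mem_vanishing (hk : 0 < k) : star b ∈ vanishing (cut q l a) := by
  refine mem_vanishing_of_star_mul_self (R.norm_cut_le hq hl) ?_
  rw [star_star, R.mul_star_eq_cfc]
  exact R.cfc_mem_vanishing hk (by fun_prop) (R.a_mem_vanishing hq hl)

omit hq hl in
/-- An element on which the spectral projections of `a` at the points of the sequences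
converge to the identity on both sides vanishes if its matrix entries do. -/
theorem eq_zero_of_compressions {x : A} (h1 : x ∈ vanishing (cut q l a))
    (h2 : star x ∈ vanishing (cut q l a))
    (h : ∀ (s : Fin l) (p : ℕ) (t : Fin l) (r : ℕ),
      proj q a (l * p + (s + 1)) * x * proj q a (l * r + (t + 1)) = 0) : x = 0 := by
  have h2' : Tendsto (fun N => cut q l a N * x) atTop (𝓝 0) := by
    have := (mem_vanishing.1 h2).star
    simpa [star_cut] using this
  -- Both outer factors are finite sums of spectral projections. Afterwards `M → ∞` with `N` fixed,
  -- then `N → ∞`.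
  have h0 : ∀ M N, (1 - cut q l a M) * x * (1 - cut q l a N) = 0 := by
    intro M N
    rw [R.cut_eq, R.cut_eq]
    simp only [sub_sub_cancel, Finset.sum_mul, Finset.mul_sum, h, Finset.sum_const_zero]
  have hN : ∀ N, x * (1 - cut q l a N) = 0 := by
    intro N
    have : Tendsto (fun M => (x - cut q l a M * x) * (1 - cut q l a N)) atTop
        (𝓝 ((x - 0) * (1 - cut q l a N))) := (tendsto_const_nhds.sub h2').mul_const _
    have h3 : (fun M => (x - cut q l a M * x) * (1 - cut q l a N)) = fun _ => 0 := by
      ext M; rw [← h0 M N, sub_mul 1, one_mul]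
    rw [h3, sub_zero] at this
    exact tendsto_nhds_unique this tendsto_const_nhds
  have h4 : Tendsto (fun N => x - x * cut q l a N) atTop (𝓝 (x - 0)) :=
    tendsto_const_nhds.sub (mem_vanishing.1 h1)
  have h5 : (fun N => x - x * cut q l a N) = fun _ => 0 := by
    ext N; rw [← hN N, mul_sub, mul_one]
  rw [h5, sub_zero] at h4
  exact tendsto_nhds_unique h4 tendsto_const_nhds

end Relations
end WPq

/-! ## The concrete operators -/

namespace WPq

open Filter Topology

/-- The basis vector `e^s_p` of the direct sum. -/
noncomputable def bas {l : ℕ} (s : Fin l) (p : ℕ) : VSum l :=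
  WithLp.toLp 2 (Pi.single s (lp.single 2 p (1 : ℂ)))

section coordinates

variable {l : ℕ}

theorem vsum_ext {x y : VSum l} (h : ∀ s p, x s p = y s p) : x = y := by
  ext s p; exact h s p

theorem bas_apply (s t : Fin l) (p r : ℕ) : bas s p t r = if s = t ∧ p = r then (1 : ℂ) else 0 := by
  by_cases h : s = t
  · subst h
    by_cases h' : p = r
    · subst h'; simp [bas]
    · simp [bas, h', Ne.symm h']
  · simp [bas, h, Ne.symm h]

theorem inner_bas (s : Fin l) (p : ℕ) (y : VSum l) : inner ℂ (bas s p) y = y s p := by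
  rw [PiLp.inner_apply, Finset.sum_eq_single s]
  · simp [bas, lp.inner_single_left]
  · intro t _ ht; simp [bas, ht]
  · simp

theorem star_apply_coord (T : VSum l →L[ℂ] VSum l) (y : VSum l) (s : Fin l) (p : ℕ) :
    (star T : VSum l →L[ℂ] VSum l) y s p = inner ℂ (T (bas s p)) y := by
  rw [← inner_bas, ContinuousLinearMap.star_eq_adjoint, ContinuousLinearMap.adjoint_inner_right]

end coordinates

/-! ### The weights of `π_s(b)` as values of `g` and `h`. -/

section coefficients

variable {q : ℝ} (hq : q ∈ Set.Ioo (0 : ℝ) 1) (k l s p : ℕ)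

/-- The substitution `m = l - r` replaces integer exponents by positive natural ones, which makes
every radicand positive. -/
theorem bCoeff_succ : bCoeff q k l (s + 1) (p + 1) = q ^ (k * (l * (p + 1) + (s + 1))) *
    ∏ m ∈ Finset.range l, √(1 - q ^ (2 * (l * p + (s + 1) + m))) := by
  rw [bCoeff, ← Finset.prod_range_reflect, Finset.range_eq_Ico, ← Finset.Ico_add_one_right_eq_Icc,
    Finset.prod_Ico_eq_prod_range, Finset.prod_Ico_eq_prod_range]
  simp only [Nat.add_sub_cancel, Nat.sub_zero, Nat.zero_add]
  congr 1
  refine Finset.prod_congr rfl fun m hm => ?_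
  have hm := Finset.mem_range.1 hm
  congr 2
  rw [← zpow_natCast]
  congr 1
  obtain ⟨d, rfl⟩ := Nat.exists_eq_add_of_lt hm
  rw [show m + d + 1 - 1 - m = d by omega]
  push_cast; ring

include hq

theorem one_sub_pow_pos (m : ℕ) : 0 < 1 - q ^ (2 * (l * p + (s + 1) + m)) := by
  have := pow_lt_one₀ hq.1.le hq.2 (n := 2 * (l * p + (s + 1) + m)) (by omega)
  linarith

theorem bCoeff_succ_pos : 0 < bCoeff q k l (s + 1) (p + 1) := by
  rw [bCoeff_succ]
  exact mul_pos (pow_pos hq.1 _) (Finset.prod_pos fun m _ =>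
    Real.sqrt_pos.2 (one_sub_pow_pos hq l s p m))

theorem bCoeff_succ_sq : bCoeff q k l (s + 1) (p + 1) ^ 2 =
    q ^ (2 * (k * (l * (p + 1) + (s + 1)))) *
      ∏ m ∈ Finset.range l, (1 - q ^ (2 * (l * p + (s + 1) + m))) := by
  rw [bCoeff_succ, mul_pow, ← pow_mul, ← Finset.prod_pow]
  congr 1
  · ring_nf
  · exact Finset.prod_congr rfl fun m _ => Real.sq_sqrt (one_sub_pow_pos hq l s p m).le

theorem bCoeff_succ_sq_eq_gPoly :
    bCoeff q k l (s + 1) (p + 1) ^ 2 = gPoly q k l (q ^ (2 * (l * p + (s + 1)))) := by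
  rw [bCoeff_succ_sq hq, gPoly, ← pow_mul, ← mul_assoc (q ^ (2 * k * l)), ← pow_add]
  congr 1
  · ring_nf
  · refine Finset.prod_congr rfl fun m _ => ?_
    rw [← pow_add]; ring_nf

theorem bCoeff_succ_sq_eq_hPoly :
    bCoeff q k l (s + 1) (p + 1) ^ 2 = hPoly q k l (q ^ (2 * (l * (p + 1) + (s + 1)))) := by
  rw [bCoeff_succ_sq hq, hPoly, ← pow_mul, ← Finset.prod_range_reflect]
  congr 1
  · ring_nf
  · refine Finset.prod_congr rfl fun m hm => ?_
    have hm := Finset.mem_range.1 hm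
    obtain ⟨d, rfl⟩ := Nat.exists_eq_add_of_lt hm
    rw [show m + d + 1 - 1 - m = d by omega, ← zpow_natCast, ← zpow_natCast, ← zpow_add₀ hq.1.ne']
    congr 2
    push_cast; ring

end coefficients

section operators

variable {q : ℝ} (hq : q ∈ Set.Ioo (0 : ℝ) 1) (k : ℕ) {l : ℕ}

theorem sumA_apply (y : VSum l) (s : Fin l) (p : ℕ) :
    sumA hq l y s p = ((q ^ (2 * (l * p + (s + 1))) : ℝ) : ℂ) * y s p := rfl

theorem sumB_apply (y : VSum l) (s : Fin l) (p : ℕ) :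
    sumB hq k l y s p = (bCoeff q k l (s + 1) (p + 1) : ℂ) * y s (p + 1) := rfl

theorem sumA_bas (s : Fin l) (p : ℕ) :
    sumA hq l (bas s p) = ((q ^ (2 * (l * p + (s + 1))) : ℝ) : ℂ) • bas s p := by
  refine vsum_ext fun t r => ?_
  rw [sumA_apply]
  simp only [PiLp.smul_apply, lp.coeFn_smul, Pi.smul_apply, smul_eq_mul, bas_apply]
  split_ifs with h
  · obtain ⟨rfl, rfl⟩ := h; rfl
  · simp

theorem sumB_bas_succ (s : Fin l) (p : ℕ) :
    sumB hq k l (bas s (p + 1)) = (bCoeff q k l (s + 1) (p + 1) : ℂ) • bas s p := by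
  refine vsum_ext fun t r => ?_
  rw [sumB_apply]
  simp only [PiLp.smul_apply, lp.coeFn_smul, Pi.smul_apply, smul_eq_mul, bas_apply,
    Nat.add_right_cancel_iff]
  split_ifs with h
  · obtain ⟨rfl, rfl⟩ := h; rfl
  · simp

theorem sumB_bas_zero (s : Fin l) : sumB hq k l (bas s 0) = 0 := by
  refine vsum_ext fun t r => ?_
  rw [sumB_apply, bas_apply]
  simp

theorem star_sumA : star (sumA hq l) = sumA hq l := by
  ext1 y
  refine vsum_ext fun s p => ?_
  rw [star_apply_coord, sumA_bas, inner_smul_left, inner_bas, sumA_apply, Complex.conj_ofReal]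

theorem star_sumB_apply_zero (y : VSum l) (s : Fin l) :
    (star (sumB hq k l) : VSum l →L[ℂ] VSum l) y s 0 = 0 := by
  rw [star_apply_coord, sumB_bas_zero, inner_zero_left]

theorem star_sumB_apply_succ (y : VSum l) (s : Fin l) (p : ℕ) :
    (star (sumB hq k l) : VSum l →L[ℂ] VSum l) y s (p + 1) =
      (bCoeff q k l (s + 1) (p + 1) : ℂ) * y s p := by
  rw [star_apply_coord, sumB_bas_succ, inner_smul_left, inner_bas, Complex.conj_ofReal]

theorem star_sumB_bas (s : Fin l) (p : ℕ) :
    (star (sumB hq k l) : VSum l →L[ℂ] VSum l) (bas s p) =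
      (bCoeff q k l (s + 1) (p + 1) : ℂ) • bas s (p + 1) := by
  refine vsum_ext fun t r => ?_
  simp only [PiLp.smul_apply, lp.coeFn_smul, Pi.smul_apply, smul_eq_mul, bas_apply]
  cases r with
  | zero => rw [star_sumB_apply_zero]; simp
  | succ r =>
    rw [star_sumB_apply_succ]
    simp only [bas_apply, Nat.add_right_cancel_iff]
    split_ifs with h
    · obtain ⟨rfl, rfl⟩ := h; rfl
    · simp

theorem pow_mul_prod_apply (c : ℕ → ℝ) (n : ℕ) (y : VSum l) (s : Fin l) (p : ℕ) :
    (sumA hq l ^ k * ((List.range n).map fun m : ℕ => 1 - (c m : ℂ) • sumA hq l).prod) y s p =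
      (((q ^ (2 * (l * p + (s + 1)))) ^ k *
        ∏ m ∈ Finset.range n, (1 - c m * q ^ (2 * (l * p + (s + 1)))) : ℝ) : ℂ) * y s p := by
  induction n generalizing y with
  | zero =>
    simp only [List.range_zero, List.map_nil, List.prod_nil, mul_one, Finset.range_zero,
      Finset.prod_empty]
    induction k generalizing y with
    | zero => simp
    | succ k ih =>
      rw [pow_succ, mul_apply_eq_comp, ih, sumA_apply]
      push_cast; ring
  | succ n ih =>
    simp only [List.range_succ, List.map_append, List.prod_append, List.map_cons, List.map_nil,
      List.prod_cons, List.prod_nil, mul_one, Finset.prod_range_succ, ← mul_assoc]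
    rw [mul_apply_eq_comp, ih]
    have : ((1 - (c n : ℂ) • sumA hq l) y) s p =
        y s p - (c n : ℂ) * (((q ^ (2 * (l * p + (s + 1))) : ℝ) : ℂ) * y s p) := rfl
    rw [this]
    push_cast; ring

theorem relations_sum : Relations q k l (sumA hq l) (sumB hq k l) where
  star_a := star_sumA hq
  a_mul_b := by
    ext1 y
    refine vsum_ext fun s p => ?_
    have h0 : (q : ℂ) ≠ 0 := by exact_mod_cast hq.1.ne'
    change sumA hq l (sumB hq k l y) s p = (q : ℂ) ^ (-(2 * l : ℤ)) * sumB hq k l (sumA hq l y) s p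
    rw [sumA_apply, sumB_apply, sumB_apply, sumA_apply, zpow_neg]
    have e : (q : ℂ) ^ (2 * (l : ℤ)) = (q : ℂ) ^ (2 * l) := by norm_cast
    rw [e]
    push_cast
    rw [show 2 * (l * (p + 1) + (s.1 + 1)) = 2 * l + 2 * (l * p + (s + 1)) by ring, pow_add]
    field_simp
  b_mul_star_b := by
    ext1 y
    refine vsum_ext fun s p => ?_
    have h := pow_mul_prod_apply hq k (fun m => q ^ (2 * m)) l y s p
    have e : ∀ m : ℕ, ((q ^ (2 * m) : ℝ) : ℂ) = (q : ℂ) ^ (2 * m) :=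
      fun m => Complex.ofReal_pow _ _
    simp only [e] at h
    change sumB hq k l ((star (sumB hq k l) : VSum l →L[ℂ] VSum l) y) s p =
      (q : ℂ) ^ (2 * k * l) * (sumA hq l ^ k * ((List.range l).map
        fun m : ℕ => 1 - ((q : ℂ) ^ (2 * m)) • sumA hq l).prod) y s p
    rw [h, sumB_apply, star_sumB_apply_succ, ← mul_assoc, ← sq, ← Complex.ofReal_pow,
      bCoeff_succ_sq_eq_gPoly hq, gPoly]
    push_cast; ring
  star_b_mul_b := by
    ext1 y
    refine vsum_ext fun s p => ?_
    have h := pow_mul_prod_apply hq k (fun m => q ^ (-(2 * ((m : ℤ) + 1)))) l y s p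
    have e : ∀ m : ℕ, ((q ^ (-(2 * ((m : ℤ) + 1))) : ℝ) : ℂ) = (q : ℂ) ^ (-(2 * ((m : ℤ) + 1))) :=
      fun m => Complex.ofReal_zpow _ _
    simp only [e] at h
    rw [h]
    change (star (sumB hq k l) : VSum l →L[ℂ] VSum l) (sumB hq k l y) s p =
      ((hPoly q k l (q ^ (2 * (l * p + (s + 1)))) : ℝ) : ℂ) * y s p
    -- At `p = 0` the left side vanishes since `b⋆` has no component there, and the right side since
    -- `q^{2(s+1)}` is a zero of `h`.
    cases p with
    | zero =>
      rw [star_sumB_apply_zero, Nat.mul_zero, Nat.zero_add, hPoly_small hq]; simp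
    | succ p =>
      rw [star_sumB_apply_succ, sumB_apply, ← mul_assoc, ← sq, ← Complex.ofReal_pow,
        bCoeff_succ_sq_eq_hPoly hq]

theorem relations_gen : Relations q k l (genA hq k l) (genB hq k l) :=
  Relations.of_jointly_injective (CWP hq k l).subtype (CWP hq k l).subtype
    (fun _ _ h _ => Subtype.ext h) (relations_sum hq k) (relations_sum hq k)

theorem generate_gen :
    (StarAlgebra.adjoin ℂ ({genA hq k l, genB hq k l} : Set (CWP hq k l))).topologicalClosure = ⊤ :=
  topologicalClosure_adjoin_coe_preimage _ _ (Set.image_pair _ _ _)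

end operators
end WPq

/-! ## Matrix units and rigidity -/

namespace WPq

open Filter Topology

section matrixUnit

variable {A : Type*} [CStarAlgebra A]

/-- The product of the coefficients of `π_s(b)` at `e_1, …, e_p`. -/
noncomputable def cumCoeff (q : ℝ) (k l s p : ℕ) : ℝ :=
  ∏ j ∈ Finset.range p, bCoeff q k l (s + 1) (j + 1)

/-- The element that corresponds to the matrix unit `e^s_p ⊗ (e^t_r)⋆` if `s = t`. -/
noncomputable def matUnit (q : ℝ) (k : ℕ) {l : ℕ} (a b : A) (s : Fin l) (p : ℕ) (t : Fin l) (r : ℕ) :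
    A :=
  (((cumCoeff q k l s p)⁻¹ * (cumCoeff q k l t r)⁻¹ : ℝ) : ℂ) •
    (star b ^ p * (proj q a (l * 0 + (s + 1)) * (proj q a (l * 0 + (t + 1)) * b ^ r)))

theorem cumCoeff_pos {q : ℝ} (hq : q ∈ Set.Ioo (0 : ℝ) 1) (k l s p : ℕ) :
    0 < cumCoeff q k l s p :=
  Finset.prod_pos fun j _ => bCoeff_succ_pos hq k l s j

theorem cumCoeff_succ (q : ℝ) (k l s p : ℕ) :
    cumCoeff q k l s (p + 1) = cumCoeff q k l s p * bCoeff q k l (s + 1) (p + 1) :=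
  Finset.prod_range_succ _ _

variable {q : ℝ} {k l : ℕ} {a b : A}

namespace Relations

variable (R : Relations q k l a b) (hq : q ∈ Set.Ioo (0 : ℝ) 1)
include R hq

theorem star_b_pow_mul_proj (p n : ℕ) :
    star b ^ p * proj q a (l * 0 + n) = proj q a (l * p + n) * star b ^ p := by
  induction p with
  | zero => simp
  | succ p ih =>
    rw [pow_succ', mul_assoc, ih, ← mul_assoc, R.star_b_mul_proj hq, mul_assoc]
    congr 2
    ring

omit R in
theorem star_b_mul_matUnit (s : Fin l) (p : ℕ) (t : Fin l) (r : ℕ) :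
    star b * matUnit q k a b s p t r =
      (bCoeff q k l (s + 1) (p + 1) : ℂ) • matUnit q k a b s (p + 1) t r := by
  have h1 := (bCoeff_succ_pos hq k l s p).ne'
  rw [matUnit, matUnit, mul_smul_comm, smul_smul, ← mul_assoc, ← pow_succ', ← Complex.ofReal_mul,
    cumCoeff_succ]
  have e : (cumCoeff q k l s p)⁻¹ * (cumCoeff q k l t r)⁻¹ = bCoeff q k l (s + 1) (p + 1) *
      ((cumCoeff q k l s p * bCoeff q k l (s + 1) (p + 1))⁻¹ * (cumCoeff q k l t r)⁻¹) := by
    field_simp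
  rw [e]

variable (hl : 0 < l)
include hl

theorem cfc_mul_matUnit {f : ℝ → ℝ} (hf : Continuous f) (s : Fin l) (p : ℕ) (t : Fin l) (r : ℕ) :
    cfc f a * matUnit q k a b s p t r =
      (f (q ^ (2 * (l * p + (s + 1)))) : ℂ) • matUnit q k a b s p t r := by
  rw [matUnit, mul_smul_comm, smul_comm, ← mul_assoc (star b ^ p), R.star_b_pow_mul_proj hq,
    mul_assoc, ← mul_assoc (cfc f a), R.cfc_mul_proj hq hl hf, smul_mul_assoc]
  simp only [Complex.coe_smul]

theorem a_mul_matUnit (s : Fin l) (p : ℕ) (t : Fin l) (r : ℕ) :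
    a * matUnit q k a b s p t r =
      ((q ^ (2 * (l * p + (s + 1))) : ℝ) : ℂ) • matUnit q k a b s p t r := by
  have := R.cfc_mul_matUnit hq hl continuous_id s p t r
  rwa [cfc_id ℝ a R.isSelfAdjoint] at this

/-- Multiply the formula for `b⋆` by `b`: on the left `b b⋆ = g(a)` acts as the square of the
coefficient, one factor of which cancels. -/
theorem b_mul_matUnit_succ (s : Fin l) (p : ℕ) (t : Fin l) (r : ℕ) :
    b * matUnit q k a b s (p + 1) t r =
      (bCoeff q k l (s + 1) (p + 1) : ℂ) • matUnit q k a b s p t r := by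
  have h1 : (bCoeff q k l (s + 1) (p + 1) : ℂ) ≠ 0 := by
    exact_mod_cast (bCoeff_succ_pos hq k l s p).ne'
  have h : b * (star b * _) = b * _ := congrArg (fun x => b * x) (star_b_mul_matUnit (k := k) (a := a) hq s p t r)
  rw [← mul_assoc, R.mul_star_eq_cfc, R.cfc_mul_matUnit hq hl (by fun_prop),
    ← bCoeff_succ_sq_eq_gPoly hq, mul_smul_comm, Complex.ofReal_pow, sq, mul_smul] at h
  exact (smul_right_injective A h1 h).symm

/-- Each step of the induction uses `b⋆ P_n b = b⋆ b P_{n+l} = h(q^{2(n+l)}) P_{n+l}`. -/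
theorem star_b_pow_mul_proj_mul_b_pow (s : Fin l) (p : ℕ) :
    star b ^ p * (proj q a (l * 0 + (s + 1)) * b ^ p) =
      ((cumCoeff q k l s p) ^ 2) • proj q a (l * p + (s + 1)) := by
  induction p with
  | zero => simp [cumCoeff]
  | succ p ih =>
    have : star b ^ (p + 1) * (proj q a (l * 0 + (s + 1)) * b ^ (p + 1)) =
        star b * (star b ^ p * (proj q a (l * 0 + (s + 1)) * b ^ p)) * b := by
      rw [pow_succ', pow_succ]; simp only [mul_assoc]
    rw [this, ih, mul_smul_comm, smul_mul_assoc, mul_assoc, R.proj_mul_b hq, ← mul_assoc,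
      R.star_mul_eq_cfc, R.cfc_mul_proj hq hl (by fun_prop), smul_smul, cumCoeff_succ, mul_pow,
      bCoeff_succ_sq_eq_hPoly hq, show l * p + (s.1 + 1) + l = l * (p + 1) + (s + 1) by ring]

theorem matUnit_self (s : Fin l) (p : ℕ) :
    matUnit q k a b s p s p = proj q a (l * p + (s + 1)) := by
  have h := (cumCoeff_pos hq k l s p).ne'
  rw [matUnit, ← mul_assoc (proj q a _), R.proj_mul_proj hq hl, if_pos rfl,
    R.star_b_pow_mul_proj_mul_b_pow hq hl, Complex.coe_smul, smul_smul]
  have e : (cumCoeff q k l s p)⁻¹ * (cumCoeff q k l s p)⁻¹ * cumCoeff q k l s p ^ 2 = 1 := by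
    field_simp
  rw [e, one_smul]

/-- The compressions of an element by the spectral projections of `a` are determined by its
matrix entries in the representation `π_1 ⊕ ⋯ ⊕ π_l`. -/
theorem proj_mul_mul_proj
    (hgen : (StarAlgebra.adjoin ℂ ({a, b} : Set A)).topologicalClosure = ⊤)
    (π : A →⋆ₐ[ℂ] (VSum l →L[ℂ] VSum l)) (ha : π a = sumA hq l) (hb : π b = sumB hq k l)
    (x : A) (s : Fin l) (p : ℕ) (t : Fin l) (r : ℕ) :
    proj q a (l * p + (s + 1)) * x * proj q a (l * r + (t + 1)) =
      π x (bas t r) s p • matUnit q k a b s p t r := by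
  have hs : π (star b) = star (sumB hq k l) := by rw [map_star, hb]
  -- `Q` collects the elements satisfying the identity. It is closed, contains `1` and is stable
  -- under left multiplication by `a`, `b`, `b⋆`, so it is everything.
  let Q : Submodule ℂ A :=
    { carrier := {y | ∀ (s : Fin l) (p : ℕ) (t : Fin l) (r : ℕ),
        proj q a (l * p + (s + 1)) * y * proj q a (l * r + (t + 1)) =
          π y (bas t r) s p • matUnit q k a b s p t r}
      add_mem' := by
        intro y z hy hz s p t r
        rw [mul_add, add_mul, hy, hz, map_add, ← add_smul]; rfl
      zero_mem' := by
        intro s p t r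
        rw [map_zero, mul_zero, zero_mul]
        exact (zero_smul _ _).symm
      smul_mem' := by
        intro c y hy s p t r
        rw [mul_smul_comm, smul_mul_assoc, hy, map_smul, smul_smul]; rfl }
  have hQa : ∀ y ∈ Q, a * y ∈ Q := by
    intro y hy s p t r
    have hc : proj q a (l * p + (s + 1)) * a = a * proj q a (l * p + (s + 1)) := by
      have := congrArg star (R.a_mul_proj hq hl (l * p + (s + 1)))
      rw [star_mul, star_smul, star_proj, R.star_a] at this
      rw [this, R.a_mul_proj hq hl]; simp
    rw [← mul_assoc, hc, mul_assoc, mul_assoc, ← mul_assoc (proj q a _), hy s p t r, mul_smul_comm,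
      R.a_mul_matUnit hq hl, smul_smul, map_mul, ha, mul_apply_eq_comp, sumA_apply, mul_comm]
  have hQb : ∀ y ∈ Q, b * y ∈ Q := by
    intro y hy s p t r
    rw [← mul_assoc, R.proj_mul_b hq, mul_assoc, mul_assoc, ← mul_assoc (proj q a _),
      show l * p + (s.1 + 1) + l = l * (p + 1) + (s + 1) by ring, hy s (p + 1) t r, mul_smul_comm,
      R.b_mul_matUnit_succ hq hl, smul_smul, map_mul, hb, mul_apply_eq_comp, sumB_apply, mul_comm]
  have hQs : ∀ y ∈ Q, star b * y ∈ Q := by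
    intro y hy s p t r
    rw [map_mul, hs, mul_apply_eq_comp]
    cases p with
    | zero =>
      have := congrArg star (R.b_mul_proj_eq_zero hq hl s)
      rw [star_mul, star_proj, star_zero] at this
      rw [star_sumB_apply_zero, ← mul_assoc, Nat.mul_zero, Nat.zero_add, this, zero_mul, zero_mul,
        zero_smul]
    | succ p =>
      rw [show l * (p + 1) + (s.1 + 1) = l * p + (s + 1) + l by ring, ← mul_assoc,
        ← R.star_b_mul_proj hq, mul_assoc, mul_assoc, ← mul_assoc (proj q a _), hy s p t r,
        mul_smul_comm, star_b_mul_matUnit hq, smul_smul, star_sumB_apply_succ, mul_comm]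
  have hQ1 : (1 : A) ∈ Q := by
    intro s p t r
    rw [map_one, mul_one, R.proj_mul_proj hq hl]
    change _ = bas t r s p • _
    rw [bas_apply]
    by_cases h : t = s ∧ r = p
    · obtain ⟨rfl, rfl⟩ := h
      simp [R.matUnit_self hq hl]
    · rw [if_neg h, if_neg, zero_smul]
      exact fun h' => h ⟨(index_injective h').1.symm, (index_injective h').2.symm⟩
  let S : Subalgebra ℂ A :=
    { carrier := {x | ∀ y ∈ Q, x * y ∈ Q}
      mul_mem' := fun hx hz y hy => by rw [mul_assoc]; exact hx _ (hz _ hy)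
      add_mem' := fun hx hz y hy => by rw [add_mul]; exact add_mem (hx _ hy) (hz _ hy)
      algebraMap_mem' := fun c y hy => by
        rw [← Algebra.smul_def]; exact Q.smul_mem c hy }
  have hadj : (StarAlgebra.adjoin ℂ ({a, b} : Set A)).toSubalgebra ≤ S := by
    rw [StarAlgebra.adjoin_toSubalgebra]
    refine Algebra.adjoin_le ?_
    have h2 : star ({a, b} : Set A) = {a, star b} := by
      rw [← Set.image_star, Set.image_pair, R.star_a]
    rw [h2]
    rintro y ((rfl | rfl) | (rfl | rfl))
    exacts [hQa, hQb, hQa, hQs]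
  have hπ : Continuous π := continuous_starAlgHom π
  have hclosed : IsClosed (Q : Set A) := by
    have : (Q : Set A) = ⋂ (s : Fin l) (p : ℕ) (t : Fin l) (r : ℕ),
        {y | proj q a (l * p + (s + 1)) * y * proj q a (l * r + (t + 1)) =
          π y (bas t r) s p • matUnit q k a b s p t r} := by
      ext y; simp only [Set.mem_iInter]; rfl
    rw [this]
    refine isClosed_iInter fun s => isClosed_iInter fun p => isClosed_iInter fun t =>
      isClosed_iInter fun r => isClosed_eq (by fun_prop) ?_
    simp only [← inner_bas s p]
    have h1 : Continuous fun y => π y (bas t r) := by fun_prop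
    exact (Continuous.inner continuous_const h1).smul continuous_const
  have hsub : closure (StarAlgebra.adjoin ℂ ({a, b} : Set A) : Set A) ⊆ Q := by
    refine closure_minimal (fun y hy => ?_) hclosed
    have := hadj hy 1 hQ1
    rwa [mul_one] at this
  have hx : x ∈ (StarAlgebra.adjoin ℂ ({a, b} : Set A)).topologicalClosure := by
    rw [hgen]; exact StarSubalgebra.mem_top
  exact hsub hx s p t r

end Relations
end matrixUnit

/-- A *-homomorphism that maps generators of a C*-algebra satisfying the relations to the operators
of `π_1 ⊕ ⋯ ⊕ π_l` is injective, if these operators admit a character vanishing on both. -/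
theorem injective_of_generators {q : ℝ} (hq : q ∈ Set.Ioo (0 : ℝ) 1) {k l : ℕ} (hk : 0 < k)
    (hl : 0 < l) {A : Type*} [CStarAlgebra A] {a b : A} (R : Relations q k l a b)
    (hgen : (StarAlgebra.adjoin ℂ ({a, b} : Set A)).topologicalClosure = ⊤)
    (ω : CWP hq k l →⋆ₐ[ℂ] ℂ) (hωa : ω (genA hq k l) = 0) (hωb : ω (genB hq k l) = 0)
    (π : A →⋆ₐ[ℂ] CWP hq k l) (ha : π a = genA hq k l) (hb : π b = genB hq k l) :
    Function.Injective π := by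
  rw [injective_iff_map_eq_zero]
  intro x hx
  -- The character used on `A` is `ω ∘ π`; it is zero at `x`, so `x` itself vanishes at infinity on
  -- both sides.
  have h := sub_character_mem_vanishing (R.norm_cut_le hq hl) hgen (R.a_mem_vanishing hq hl)
    (R.star_a.symm ▸ R.a_mem_vanishing hq hl) (R.b_mem_vanishing hq hl hk)
    (R.star_b_mem_vanishing hq hl hk) (ω.comp π) (by rw [StarAlgHom.comp_apply, ha, hωa])
    (by rw [StarAlgHom.comp_apply, hb, hωb]) x
  rw [StarAlgHom.comp_apply, hx, map_zero, map_zero, sub_zero] at h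
  refine R.eq_zero_of_compressions h.1 h.2 fun s p t r => ?_
  rw [R.proj_mul_mul_proj hq hl hgen ((CWP hq k l).subtype.comp π) (by
    rw [StarAlgHom.comp_apply, ha]; rfl) (by rw [StarAlgHom.comp_apply, hb]; rfl),
    StarAlgHom.comp_apply, hx, map_zero]
  exact zero_smul _ _

/-- An injective *-homomorphism whose range contains generators is surjective. -/
theorem surjective_of_generators {A B : Type*} [CStarAlgebra A] [CStarAlgebra B] {a b : A} {c d : B}
    (hgen : (StarAlgebra.adjoin ℂ ({c, d} : Set B)).topologicalClosure = ⊤)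
    (π : A →⋆ₐ[ℂ] B) (ha : π a = c) (hb : π b = d)
    (hinj : Function.Injective π) : Function.Surjective π := by
  -- An injective *-homomorphism is isometric, so its range is complete.
  have hcl : IsClosed (π.range : Set B) :=
    (NonUnitalStarAlgHom.isometry π hinj).isClosedEmbedding.isClosed_range
  exact fun y => mem_of_generate hgen π.range hcl ⟨a, ha⟩ ⟨b, hb⟩ y

end WPq

/-! ## Compact operators on `ℓ²(ℕ)` -/

namespace WPq

open Filter Topology

/-- Contractions that converge strongly to the identity converge in norm after a compact
operator. -/
theorem tendsto_comp_of_isCompactOperator {E : Type*} [NormedAddCommGroup E] [NormedSpace ℂ E]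
    {Q : ℕ → E →L[ℂ] E} (hQ : ∀ N, ‖Q N‖ ≤ 1) (hlim : ∀ x, Tendsto (fun N => Q N x) atTop (𝓝 x))
    {T : E →L[ℂ] E} (hT : IsCompactOperator T) :
    Tendsto (fun N => Q N * T) atTop (𝓝 T) := by
  rw [Metric.tendsto_atTop]
  intro ε hε
  have hT' : IsCompactOperator (T : E →ₗ[ℂ] E) := hT
  have htb : TotallyBounded ((T : E →ₗ[ℂ] E) '' Metric.closedBall 0 1) :=
    (hT'.isCompact_closure_image_closedBall 1).totallyBounded.subset subset_closure
  -- Three errors below `ε / 6` give the bound `ε / 2`, which leaves room for the strict inequality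
  -- after the supremum.
  obtain ⟨t, htf, hcov⟩ := Metric.totallyBounded_iff.1 htb (ε / 6) (by positivity)
  have hev : ∀ᶠ N in atTop, ∀ y ∈ t, dist (Q N y) y < ε / 6 :=
    htf.eventually_all.2 fun y _ => (Metric.tendsto_nhds.1 (hlim y)) _ (by positivity)
  obtain ⟨N, hN⟩ := eventually_atTop.1 hev
  refine ⟨N, fun n hn => ?_⟩
  rw [dist_eq_norm]
  refine lt_of_le_of_lt (ContinuousLinearMap.opNorm_le_of_unit_norm (C := ε / 2) (by positivity)
    fun x hx => ?_) (by linarith)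
  have hx' : T x ∈ (T : E →ₗ[ℂ] E) '' Metric.closedBall 0 1 :=
    ⟨x, by simp [hx], rfl⟩
  obtain ⟨y, hy, hxy⟩ := Set.mem_iUnion₂.1 (hcov hx')
  have h1 := hN n hn y hy
  rw [Metric.mem_ball, dist_eq_norm] at hxy
  rw [dist_eq_norm] at h1
  have h2 : ‖Q n (T x - y)‖ ≤ ‖T x - y‖ :=
    ((Q n).le_opNorm _).trans (mul_le_of_le_one_left (norm_nonneg _) (hQ n))
  have e : (Q n * T - T) x = Q n (T x - y) + (Q n y - y) - (T x - y) := by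
    change Q n (T x) - T x = _
    rw [map_sub]; abel
  rw [e]
  have h3 := norm_sub_le (Q n (T x - y) + (Q n y - y)) (T x - y)
  have h4 := norm_add_le (Q n (T x - y)) (Q n y - y)
  linarith

section sequences

/-- The basis vector `e_p` of `ℓ²(ℕ)`. -/
noncomputable def vec (p : ℕ) : V := lp.single 2 p (1 : ℂ)

theorem vec_apply (p r : ℕ) : vec p r = if r = p then (1 : ℂ) else 0 := by
  by_cases h : r = p
  · subst h; simp [vec]
  · simp [vec, h]

theorem inner_vec (p : ℕ) (x : V) : inner ℂ (vec p) x = x p := by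
  simp [vec, lp.inner_single_left]

/-- The rank one operator `e_p ⊗ e_r⋆`. -/
noncomputable def vecUnit (p r : ℕ) : V →L[ℂ] V := InnerProductSpace.rankOne ℂ (vec p) (vec r)

theorem vecUnit_apply (p r : ℕ) (x : V) : vecUnit p r x = x r • vec p := by
  rw [vecUnit, InnerProductSpace.rankOne_apply, inner_vec]

theorem isCompactOperator_vecUnit (p r : ℕ) : IsCompactOperator (vecUnit p r) := by
  have h : IsCompactOperator (ContinuousLinearMap.toSpanSingleton ℂ (vec p)) :=
    isCompactOperator_of_locallyCompactSpace_rng _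
  exact h.comp_clm (innerSL ℂ (vec r))

/-- The projection of `ℓ²(ℕ)` onto the first `N` coordinates. -/
noncomputable def truncate (N : ℕ) : V →L[ℂ] V := ∑ p ∈ Finset.range N, vecUnit p p

theorem truncate_eq (N : ℕ) (x : V) :
    truncate N x = ∑ p ∈ Finset.range N, lp.single 2 p (x p) := by
  rw [truncate, sum_apply]
  refine Finset.sum_congr rfl fun p _ => ?_
  rw [vecUnit_apply, vec, ← lp.single_smul, smul_eq_mul, mul_one]

theorem truncate_apply (N : ℕ) (x : V) (r : ℕ) :
    truncate N x r = if r < N then x r else 0 := by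
  rw [truncate, sum_apply, lp.coeFn_sum, Finset.sum_apply]
  simp only [vecUnit_apply, lp.coeFn_smul, Pi.smul_apply, vec_apply, smul_eq_mul, mul_ite, mul_one,
    mul_zero, Finset.sum_ite_eq, Finset.mem_range]

theorem isCompactOperator_truncate (N : ℕ) : IsCompactOperator (truncate N) :=
  sum_mem (S := compactOps V) fun p _ => isCompactOperator_vecUnit p p

theorem star_truncate (N : ℕ) : star (truncate N) = truncate N := by
  rw [truncate, star_sum]
  refine Finset.sum_congr rfl fun p _ => ?_
  rw [vecUnit, ContinuousLinearMap.star_eq_adjoint, InnerProductSpace.adjoint_rankOne]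

theorem norm_le_of_weights {T : V →L[ℂ] V} {ε : ℝ} (hε : 0 ≤ ε) {τ : ℕ → ℕ}
    (hτ : Function.Injective τ) (h : ∀ x p, ‖T x p‖ ≤ ε * ‖x (τ p)‖) : ‖T‖ ≤ ε := by
  refine T.opNorm_le_bound hε fun x => ?_
  have h0 : (0 : ℝ) < (2 : ℝ≥0∞).toReal := by norm_num
  have hw := memlp_weighted (w := fun _ => 1) (by simp) hτ x
  simp only [Complex.ofReal_one, one_mul] at hw
  have hsq : ∀ y : V, ‖y‖ ^ 2 = ∑' p, ‖y p‖ ^ 2 := fun y => by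
    simpa using lp.norm_rpow_eq_tsum h0 y
  have hT : Summable fun p => ‖T x p‖ ^ 2 := by
    simpa using (lp.memℓp (T x)).summable h0
  refine le_of_sq_le_sq ?_ (by positivity)
  rw [mul_pow, hsq, hsq]
  calc ∑' p, ‖T x p‖ ^ 2 ≤ ∑' p, ε ^ 2 * ‖x (τ p)‖ ^ 2 := by
        refine hT.tsum_le_tsum (fun p => ?_) (hw.1.mul_left _)
        rw [← mul_pow]
        exact pow_le_pow_left₀ (norm_nonneg _) (h x p) 2
    _ = ε ^ 2 * ∑' p, ‖x (τ p)‖ ^ 2 := tsum_mul_left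
    _ ≤ _ := mul_le_mul_of_nonneg_left hw.2 (sq_nonneg _)

theorem norm_truncate_le (N : ℕ) : ‖truncate N‖ ≤ 1 := by
  refine norm_le_of_weights zero_le_one Function.injective_id fun x p => ?_
  rw [truncate_apply, one_mul]
  split_ifs <;> simp

theorem tendsto_truncate (x : V) : Tendsto (fun N => truncate N x) atTop (𝓝 x) := by
  simp only [truncate_eq]
  exact (lp.hasSum_single (by simp) x).tendsto_sum_nat

theorem isCompactOperator_weightedOp {w : ℕ → ℝ} (hw : ∀ p, |w p| ≤ 1) {τ : ℕ → ℕ}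
    (hτ : Function.Injective τ) (h0 : Tendsto w atTop (𝓝 0)) :
    IsCompactOperator (weightedOp w hw τ hτ) := by
  have hlim : Tendsto (fun N => truncate N * weightedOp w hw τ hτ) atTop
      (𝓝 (weightedOp w hw τ hτ)) := by
    rw [Metric.tendsto_atTop]
    intro ε hε
    obtain ⟨N, hN⟩ := Metric.tendsto_atTop.1 h0 (ε / 2) (by positivity)
    refine ⟨N, fun n hn => ?_⟩
    rw [dist_eq_norm]
    refine lt_of_le_of_lt (norm_le_of_weights (ε := ε / 2) (by positivity) hτ fun x p => ?_)
      (by linarith)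
    have e : (truncate n * weightedOp w hw τ hτ - weightedOp w hw τ hτ) x p =
        truncate n (weightedOp w hw τ hτ x) p - w p * x (τ p) := rfl
    rw [e, truncate_apply, weightedOp_apply]
    split_ifs with h
    · rw [sub_self, norm_zero]; positivity
    · have := hN p (by omega)
      rw [dist_zero_right, Real.norm_eq_abs] at this
      rw [zero_sub, norm_neg, norm_mul, Complex.norm_real, Real.norm_eq_abs]
      gcongr
  exact isCompactOperator_of_tendsto hlim
    (Eventually.of_forall fun N => (isCompactOperator_truncate N).comp_clm _)

theorem tendsto_truncate_mul_mul_truncate {T : V →L[ℂ] V} (hT : IsCompactOperator T) :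
    Tendsto (fun N => truncate N * T * truncate N) atTop (𝓝 T) := by
  have h1 := tendsto_comp_of_isCompactOperator norm_truncate_le tendsto_truncate hT
  -- Right truncation is the adjoint of left truncation of the compact operator `T⋆`.
  have h2 : Tendsto (fun N => T * truncate N) atTop (𝓝 T) := by
    have := (tendsto_comp_of_isCompactOperator norm_truncate_le tendsto_truncate
      (isCompactOperator_star hT)).star
    simpa [star_truncate] using this
  have h3 : Tendsto (fun N => truncate N * (T * truncate N - T)) atTop (𝓝 0) := by
    rw [tendsto_zero_iff_norm_tendsto_zero]
    have h4 := tendsto_iff_norm_sub_tendsto_zero.1 h2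
    refine squeeze_zero (fun _ => norm_nonneg _) (fun N => ?_) h4
    exact (norm_mul_le _ _).trans (mul_le_of_le_one_left (norm_nonneg _) (norm_truncate_le N))
  have := h3.add h1
  rw [zero_add] at this
  refine this.congr fun N => ?_
  rw [mul_sub, mul_assoc]; abel

theorem truncate_mul_mul_truncate (T : V →L[ℂ] V) (N : ℕ) :
    truncate N * T * truncate N =
      ∑ p ∈ Finset.range N, ∑ r ∈ Finset.range N, (T (vec r) p) • vecUnit p r := by
  have h : ∀ p r, vecUnit p p * T * vecUnit r r = (T (vec r) p) • vecUnit p r := by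
    intro p r
    ext1 x
    change vecUnit p p (T (vecUnit r r x)) = (T (vec r) p) • vecUnit p r x
    rw [vecUnit_apply r, map_smul, map_smul, vecUnit_apply, vecUnit_apply, smul_comm]
  simp only [truncate, Finset.sum_mul, Finset.mul_sum, h]
  rw [Finset.sum_comm]

/-- Left truncations of a compact operator converge in norm, but here the `N`-th error at `e_N` has
norm `‖z‖`. -/
theorem not_isCompactOperator_smul_one {z : ℂ} (hz : z ≠ 0) :
    ¬ IsCompactOperator (z • (1 : V →L[ℂ] V)) := by
  intro hc
  have h := tendsto_iff_norm_sub_tendsto_zero.1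
    (tendsto_comp_of_isCompactOperator norm_truncate_le tendsto_truncate hc)
  have hle : ∀ N, ‖z‖ ≤ ‖truncate N * (z • (1 : V →L[ℂ] V)) - z • (1 : V →L[ℂ] V)‖ := by
    intro N
    have hn : ‖vec N‖ = 1 := by simp [vec]
    have h0 : truncate N (vec N) = 0 := by
      ext r
      rw [truncate_apply, vec_apply]
      by_cases h : r = N <;> simp [h]
    have e : (truncate N * (z • (1 : V →L[ℂ] V)) - z • (1 : V →L[ℂ] V)) (vec N) =
        truncate N (z • vec N) - z • vec N := rfl
    have h1 := (truncate N * (z • (1 : V →L[ℂ] V)) - z • (1 : V →L[ℂ] V)).le_opNorm (vec N)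
    rwa [e, map_smul, h0, smul_zero, zero_sub, norm_neg, norm_smul, hn, mul_one, mul_one] at h1
  have := ge_of_tendsto' h hle
  exact hz (norm_le_zero_iff.1 this)

end sequences

section generators

variable {q : ℝ} (hq : q ∈ Set.Ioo (0 : ℝ) 1) {k l : ℕ}
include hq

theorem tendsto_pow_mul_add (hk : 0 < k) (hl : 0 < l) (s : ℕ) :
    Tendsto (fun p => q ^ (k * (l * p + s))) atTop (𝓝 0) := by
  refine (tendsto_pow_atTop_nhds_zero_of_lt_one hq.1.le hq.2).comp ?_
  refine tendsto_atTop_mono (fun p => ?_) tendsto_id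
  calc p ≤ l * p := Nat.le_mul_of_pos_left p hl
    _ ≤ l * p + s := Nat.le_add_right _ _
    _ ≤ _ := Nat.le_mul_of_pos_left _ hk

theorem isCompactOperator_piA (hl : 0 < l) (s : ℕ) : IsCompactOperator (piA hq l s) :=
  isCompactOperator_weightedOp _ _ (tendsto_pow_mul_add hq two_pos hl s)

theorem isCompactOperator_piB (hk : 0 < k) (hl : 0 < l) (s : ℕ) :
    IsCompactOperator (piB hq k l (s + 1)) := by
  refine isCompactOperator_weightedOp _ _ ?_
  have h1 := (tendsto_pow_mul_add hq hk hl (s + 1)).comp (tendsto_add_atTop_nat 1)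
  refine squeeze_zero (fun p => (bCoeff_succ_pos hq k l s p).le) (fun p => ?_) h1
  have h0 := hq.1
  rw [bCoeff_succ]
  refine mul_le_of_le_one_right (by positivity) ?_
  refine Finset.prod_le_one (fun _ _ => Real.sqrt_nonneg _) fun m _ => ?_
  rw [Real.sqrt_le_one]
  have : 0 < q ^ (2 * (l * p + (s + 1) + m)) := by positivity
  linarith

end generators
end WPq

/-! ## The unitization of the compact operators -/

namespace WPq

open Filter Topology

section functionalCalculus

variable {A B : Type*} [CStarAlgebra A] [CStarAlgebra B] (q : ℝ) (n : ℕ)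

/-- The eigenvalue equation says that `x` intertwines `a` with the scalar `α`. -/
theorem proj_mul_of_eigen {a x : A} {α : ℝ} (ha : star a = a) (h : a * x = (α : ℂ) • x) :
    proj q a n * x = (bump q n α : ℂ) • x := by
  have hint : a * x = x * algebraMap ℝ A α := by
    rw [h, Algebra.algebraMap_eq_smul_one, mul_smul_comm, mul_one, Complex.coe_smul]
  rw [proj, cfc_mul_eq_mul_cfc ha ((IsSelfAdjoint.all α).algebraMap A) hint (continuous_bump q n),
    cfc_algebraMap, Algebra.algebraMap_eq_smul_one, mul_smul_comm, mul_one, Complex.coe_smul]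

theorem map_proj (φ : A →⋆ₐ[ℂ] B) {a : A} (ha : star a = a) :
    φ (proj q a n) = proj q (φ a) n :=
  have ha' : IsSelfAdjoint a := ha
  StarAlgHom.map_cfc φ (bump q n) a (continuous_bump q n).continuousOn (continuous_starAlgHom φ) ha' (ha'.map φ)

/-- An injective *-homomorphism from a unitization whose range contains generators
is surjective. -/
theorem surjective_of_unitization {I : Type*} [NonUnitalCStarAlgebra I] {c d : B}
    (hgen : (StarAlgebra.adjoin ℂ ({c, d} : Set B)).topologicalClosure = ⊤)
    (φ : Unitization ℂ I →⋆ₐ[ℂ] B) {a b : I} (ha : φ a = c) (hb : φ b = d)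
    (hinj : Function.Injective φ) : Function.Surjective φ :=
  surjective_of_generators hgen φ ha hb hinj

end functionalCalculus

section blocks

variable {l : ℕ}

/-- The inclusion of the summand `V_s`. -/
noncomputable def blockIncl (s : Fin l) : V →L[ℂ] VSum l :=
  ((PiLp.continuousLinearEquiv 2 ℂ (fun _ : Fin l => V)).symm : (Fin l → V) →L[ℂ] VSum l) ∘L
    ContinuousLinearMap.single ℂ (fun _ : Fin l => V) s

theorem blockIncl_apply (s : Fin l) (x : V) : blockIncl s x = WithLp.toLp 2 (Pi.single s x) := rfl

/-- The extension by zero of an operator on the summand `V_s`. -/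
noncomputable def blockSingle (s : Fin l) (T : V →L[ℂ] V) : VSum l →L[ℂ] VSum l :=
  blockIncl s ∘L T ∘L PiLp.proj 2 (fun _ : Fin l => V) s

theorem blockSingle_apply (s : Fin l) (T : V →L[ℂ] V) (x : VSum l) :
    blockSingle s T x = WithLp.toLp 2 (Pi.single s (T (x s))) := rfl

theorem continuous_blockSingle (s : Fin l) : Continuous (blockSingle s) := by
  exact continuous_const.clm_comp (continuous_id.clm_comp continuous_const)

theorem blockDiag_eq_sum (T : Fin l → (V →L[ℂ] V)) :
    blockDiag T = ∑ s, blockSingle s (T s) := by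
  ext1 x
  rw [sum_apply]
  ext1
  simp only [blockSingle_apply, WithLp.ofLp_sum]
  exact congrFun (Finset.univ_sum_single (fun s => T s (x s))).symm _

theorem blockSingle_sum_smul (s : Fin l) (N : ℕ) (c : ℕ → ℕ → ℂ) (U : ℕ → ℕ → V →L[ℂ] V) :
    blockSingle s (∑ p ∈ Finset.range N, ∑ r ∈ Finset.range N, c p r • U p r) =
      ∑ p ∈ Finset.range N, ∑ r ∈ Finset.range N, c p r • blockSingle s (U p r) := by
  let φ : (V →L[ℂ] V) →ₗ[ℂ] (VSum l →L[ℂ] VSum l) :=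
    { toFun := blockSingle s
      map_add' := fun S T => by simp [blockSingle]
      map_smul' := fun c T => by simp [blockSingle] }
  change φ _ = ∑ p ∈ Finset.range N, ∑ r ∈ Finset.range N, c p r • φ (U p r)
  simp only [map_sum, map_smul]

theorem blockSingle_vecUnit_apply (s : Fin l) (p r : ℕ) (y : VSum l) :
    blockSingle s (vecUnit p r) y = y s r • bas s p := by
  rw [blockSingle_apply, vecUnit_apply, Pi.single_smul, WithLp.toLp_smul]
  rfl

/-- The direct sum of compact operators, as a *-homomorphism. -/
noncomputable def blockHom (l : ℕ) :
    (Fin l → compactOps V) →⋆ₙₐ[ℂ] (VSum l →L[ℂ] VSum l) where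
  toFun T := blockDiag fun s => (T s : V →L[ℂ] V)
  map_smul' _ _ := rfl
  map_zero' := rfl
  map_add' _ _ := rfl
  map_mul' _ _ := rfl
  map_star' T := by
    rw [ContinuousLinearMap.star_eq_adjoint, ContinuousLinearMap.eq_adjoint_iff]
    intro x y
    rw [PiLp.inner_apply, PiLp.inner_apply]
    exact Finset.sum_congr rfl fun s _ => ContinuousLinearMap.adjoint_inner_left (T s : V →L[ℂ] V) _ _

end blocks

section units

variable {q : ℝ} (hq : q ∈ Set.Ioo (0 : ℝ) 1) (k : ℕ) {l : ℕ}

include hq in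
theorem proj_sumA_bas (n : ℕ) (s : Fin l) (p : ℕ) :
    proj q (sumA hq l) n (bas s p) = (bump q n (q ^ (2 * (l * p + (s + 1)))) : ℂ) • bas s p := by
  -- A rank one operator turns the eigenvector into an element of the algebra, to which
  -- `proj_mul_of_eigen` applies.
  set X : VSum l →L[ℂ] VSum l := InnerProductSpace.rankOne ℂ (bas s p) (bas s p) with hX
  have hbas : X (bas s p) = bas s p := by
    rw [hX, InnerProductSpace.rankOne_apply, inner_bas, bas_apply, if_pos ⟨rfl, rfl⟩, one_smul]
  have hint : sumA hq l * X = ((q ^ (2 * (l * p + (s + 1))) : ℝ) : ℂ) • X := by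
    ext1 y
    change sumA hq l (X y) = ((q ^ (2 * (l * p + (s + 1))) : ℝ) : ℂ) • X y
    rw [hX, InnerProductSpace.rankOne_apply, map_smul, sumA_bas, smul_comm]
  have h := congrArg (fun T : VSum l →L[ℂ] VSum l => T (bas s p))
    (proj_mul_of_eigen q n (star_sumA hq) hint)
  change proj q (sumA hq l) n (X (bas s p)) =
    (bump q n (q ^ (2 * (l * p + (s + 1)))) : ℂ) • X (bas s p) at h
  rwa [hbas] at h

theorem proj_sumA_apply (s : Fin l) (y : VSum l) :
    proj q (sumA hq l) (l * 0 + (s + 1)) y = y s 0 • bas s 0 := by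
  refine vsum_ext fun t r => ?_
  rw [← inner_bas t r, ← ContinuousLinearMap.adjoint_inner_left,
    ← ContinuousLinearMap.star_eq_adjoint, star_proj, proj_sumA_bas hq,
    inner_smul_left, inner_bas, Complex.conj_ofReal]
  simp only [PiLp.smul_apply, lp.coeFn_smul, Pi.smul_apply, smul_eq_mul, bas_apply]
  by_cases h : s = t ∧ 0 = r
  · obtain ⟨rfl, rfl⟩ := h
    rw [bump_self hq]; simp
  · rw [if_neg h, bump_ne hq]
    · simp
    · exact fun h' => h ⟨(index_injective h').1.symm, (index_injective h').2.symm⟩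

theorem star_sumB_pow_bas (s : Fin l) (p : ℕ) :
    (star (sumB hq k l) ^ p : VSum l →L[ℂ] VSum l) (bas s 0) =
      (cumCoeff q k l s p : ℂ) • bas s p := by
  induction p with
  | zero => simp [cumCoeff]
  | succ p ih =>
    rw [pow_succ', mul_apply_eq_comp, ih, map_smul, star_sumB_bas, smul_smul, cumCoeff_succ,
      Complex.ofReal_mul]

theorem sumB_pow_apply_zero (s : Fin l) (r : ℕ) (y : VSum l) :
    (sumB hq k l ^ r : VSum l →L[ℂ] VSum l) y s 0 = (cumCoeff q k l s r : ℂ) * y s r := by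
  rw [← inner_bas s 0, ← ContinuousLinearMap.adjoint_inner_left,
    ← ContinuousLinearMap.star_eq_adjoint, star_pow, star_sumB_pow_bas, inner_smul_left, inner_bas,
    Complex.conj_ofReal]

/-- Functional calculus commutes with the inclusion, so the projection can be formed inside the
closed algebra. -/
theorem proj_sumA_mem (n : ℕ) : proj q (sumA hq l) n ∈ CWP hq k l := by
  have h := map_proj q n (CWP hq k l).subtype (relations_gen hq k).star_a
  have h' : ((proj q (genA hq k l) n : CWP hq k l) : VSum l →L[ℂ] VSum l) =
    proj q (sumA hq l) n := h
  rw [← h']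
  exact SetLike.coe_mem _

theorem blockSingle_vecUnit_mem (s : Fin l) (p r : ℕ) :
    blockSingle s (vecUnit p r) ∈ CWP hq k l := by
  have hp : (cumCoeff q k l s p : ℂ) ≠ 0 := by exact_mod_cast (cumCoeff_pos hq k l s p).ne'
  have hr : (cumCoeff q k l s r : ℂ) ≠ 0 := by exact_mod_cast (cumCoeff_pos hq k l s r).ne'
  have e : blockSingle s (vecUnit p r) =
      ((cumCoeff q k l s p : ℂ)⁻¹ * (cumCoeff q k l s r : ℂ)⁻¹) •
        (star (sumB hq k l) ^ p * (proj q (sumA hq l) (l * 0 + (s + 1)) * sumB hq k l ^ r)) := by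
    ext1 y
    rw [blockSingle_vecUnit_apply, smul_apply, mul_apply_eq_comp,
      mul_apply_eq_comp, proj_sumA_apply, map_smul, star_sumB_pow_bas, sumB_pow_apply_zero,
      smul_smul, smul_smul]
    congr 1
    field_simp
  have hb : sumB hq k l ∈ CWP hq k l := (genB hq k l).2
  rw [e]
  exact (CWP hq k l).smul_mem (mul_mem (pow_mem (star_mem hb) _)
    (mul_mem (proj_sumA_mem hq k _) (pow_mem hb _))) _

/-- `T` is the norm limit of its truncations, which are finite combinations of matrix units. -/
theorem blockSingle_mem {T : V →L[ℂ] V} (hT : IsCompactOperator T) (s : Fin l) :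
    blockSingle s T ∈ CWP hq k l := by
  have h := ((continuous_blockSingle s).tendsto T).comp (tendsto_truncate_mul_mul_truncate hT)
  refine (instIsClosedCWP hq k l).mem_of_tendsto h (Eventually.of_forall fun N => ?_)
  change blockSingle s (truncate N * T * truncate N) ∈ CWP hq k l
  rw [truncate_mul_mul_truncate, blockSingle_sum_smul]
  exact sum_mem fun p _ => sum_mem fun r _ =>
    (CWP hq k l).smul_mem (blockSingle_vecUnit_mem hq k s p r) _

theorem blockHom_mem (T : Fin l → compactOps V) : blockHom l T ∈ CWP hq k l := by
  change blockDiag (fun s => (T s : V →L[ℂ] V)) ∈ CWP hq k l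
  rw [blockDiag_eq_sum]
  exact sum_mem fun s _ => blockSingle_mem hq k (T s).2 s

/-- The *-homomorphism from the unitization of the direct sum of the compact operators to the
concrete algebra. -/
noncomputable def unitizationHom (l : ℕ) :
    Unitization ℂ (Fin l → compactOps V) →⋆ₐ[ℂ] CWP hq k l :=
  StarAlgHom.codRestrict (Unitization.starLift (blockHom l)) (CWP hq k l) fun x => by
    change algebraMap ℂ (VSum l →L[ℂ] VSum l) x.fst + blockHom l x.snd ∈ CWP hq k l
    exact add_mem (algebraMap_mem _ _) (blockHom_mem hq k _)

theorem coe_unitizationHom (x : Unitization ℂ (Fin l → compactOps V)) :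
    (unitizationHom hq k l x : VSum l →L[ℂ] VSum l) =
      algebraMap ℂ (VSum l →L[ℂ] VSum l) x.fst + blockHom l x.snd := rfl

theorem unitizationHom_injective (hl : 0 < l) : Function.Injective (unitizationHom hq k l) := by
  rw [injective_iff_map_eq_zero]
  intro x hx
  have h0 : algebraMap ℂ (VSum l →L[ℂ] VSum l) x.fst + blockHom l x.snd = 0 := by
    rw [← coe_unitizationHom hq k, hx]; rfl
  have h1 : ∀ (s : Fin l) (v : V), x.fst • v + (x.snd s : V →L[ℂ] V) v = 0 := by
    intro s v
    have h2 := congrArg (fun T : VSum l →L[ℂ] VSum l => (T (blockIncl s v)) s) h0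
    have h3 : x.fst • (blockIncl s v) s + (x.snd s : V →L[ℂ] V) ((blockIncl s v) s) = 0 := h2
    have h4 : (blockIncl s v) s = v := by rw [blockIncl_apply]; simp
    rwa [h4] at h3
  -- A nonzero scalar part would make a nonzero multiple of the identity compact on the first block,
  -- which exists as `l > 0`.
  have hz : x.fst = 0 := by
    by_contra hne
    refine not_isCompactOperator_smul_one (neg_ne_zero.2 hne) ?_
    have : (x.snd ⟨0, hl⟩ : V →L[ℂ] V) = (-x.fst) • (1 : V →L[ℂ] V) := by
      ext1 v
      have := h1 ⟨0, hl⟩ v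
      rw [add_comm] at this
      rw [eq_neg_of_add_eq_zero_left this, ← neg_smul]; rfl
    rw [← this]
    exact (x.snd ⟨0, hl⟩).2
  refine Unitization.ext hz ?_
  funext s
  refine Subtype.ext ?_
  ext1 v
  have := h1 s v
  rwa [hz, zero_smul, zero_add] at this

theorem unitizationHom_inr_piA (hl : 0 < l) :
    unitizationHom hq k l (((fun s : Fin l => ⟨piA hq l (s + 1), isCompactOperator_piA hq hl _⟩) :
      Fin l → compactOps V) : Unitization ℂ (Fin l → compactOps V)) = genA hq k l := by
  refine Subtype.ext ?_
  rw [coe_unitizationHom, Unitization.fst_inr, map_zero, zero_add]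
  rfl

theorem unitizationHom_inr_piB (hk : 0 < k) (hl : 0 < l) :
    unitizationHom hq k l
      (((fun s : Fin l => ⟨piB hq k l (s + 1), isCompactOperator_piB hq hk hl _⟩) :
      Fin l → compactOps V) : Unitization ℂ (Fin l → compactOps V)) = genB hq k l := by
  refine Subtype.ext ?_
  rw [coe_unitizationHom, Unitization.fst_inr, map_zero, zero_add]
  rfl

theorem unitizationHom_bijective (hk : 0 < k) (hl : 0 < l) :
    Function.Bijective (unitizationHom hq k l) := by
  have hinj := unitizationHom_injective hq k hl
  refine ⟨hinj, ?_⟩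
  refine @surjective_of_unitization (CWP hq k l) _ (Fin l → compactOps V) _ (genA hq k l)
    (genB hq k l) (generate_gen hq k) (unitizationHom hq k l)
    (fun s => ⟨piA hq l (s + 1), isCompactOperator_piA hq hl _⟩)
    (fun s => ⟨piB hq k l (s + 1), isCompactOperator_piB hq hk hl _⟩) ?_ ?_ hinj
  · exact unitizationHom_inr_piA hq k hl
  · exact unitizationHom_inr_piB hq k hk hl

end units
end WPq

/-! ## The universal property and the extension -/

namespace WPq

/-- The inverse of a bijective *-homomorphism. -/
noncomputable def inverseHom {A B : Type*} [Semiring A] [Algebra ℂ A] [Star A] [Semiring B]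
    [Algebra ℂ B] [Star B] (φ : A →⋆ₐ[ℂ] B) (hφ : Function.Bijective φ) : B →⋆ₐ[ℂ] A :=
  ((StarAlgEquiv.ofBijective φ hφ).symm : B →⋆ₐ[ℂ] A)

theorem inverseHom_apply {A B : Type*} [Semiring A] [Algebra ℂ A] [Star A] [Semiring B]
    [Algebra ℂ B] [Star B] (φ : A →⋆ₐ[ℂ] B) (hφ : Function.Bijective φ) (x : A) :
    inverseHom φ hφ (φ x) = x :=
  (StarAlgEquiv.ofBijective φ hφ).symm_apply_apply x

/-- If every *-homomorphism onto `A` that matches generators satisfying the relations is bijective,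
then `A` maps to every C*-algebra with elements satisfying the relations. -/
theorem exists_hom_of_bijective {q : ℝ} {k l : ℕ} {A : Type u} {B : Type v} [CStarAlgebra A]
    [CStarAlgebra B] {a b : A} {c d : B} (hab : Relations q k l a b) (hcd : Relations q k l c d)
    (hbij : ∀ (D : Type max u v) [CStarAlgebra D] (a' b' : D), Relations q k l a' b' →
      (StarAlgebra.adjoin ℂ ({a', b'} : Set D)).topologicalClosure = ⊤ →
      ∀ π : D →⋆ₐ[ℂ] A, π a' = a → π b' = b → Function.Bijective π) :
    ∃ φ : A →⋆ₐ[ℂ] B, φ a = c ∧ φ b = d := by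
  -- The closed algebra `D` generated by these pairs is the graph of the homomorphism sought;
  -- bijectivity of the first projection says so.
  let s : Set (A × B) := {(a, c), (b, d)}
  let D : StarSubalgebra ℂ (A × B) := (StarAlgebra.adjoin ℂ s).topologicalClosure
  have : IsClosed (D : Set (A × B)) := StarSubalgebra.isClosed_topologicalClosure _
  have hs : s ⊆ D := (StarAlgebra.subset_adjoin ℂ s).trans (StarSubalgebra.le_topologicalClosure _)
  let a' : D := ⟨(a, c), hs (Set.mem_insert _ _)⟩
  let b' : D := ⟨(b, d), hs (Set.mem_insert_of_mem _ rfl)⟩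
  let π₁ : D →⋆ₐ[ℂ] A := (StarAlgHom.fst ℂ A B).comp D.subtype
  let π₂ : D →⋆ₐ[ℂ] B := (StarAlgHom.snd ℂ A B).comp D.subtype
  have R : Relations q k l a' b' := Relations.of_jointly_injective π₁ π₂
    (fun x y h1 h2 => Subtype.ext (Prod.ext h1 h2)) hab hcd
  have hgen : (StarAlgebra.adjoin ℂ ({a', b'} : Set D)).topologicalClosure = ⊤ :=
    topologicalClosure_adjoin_coe_preimage s {a', b'} (Set.image_pair _ _ _)
  have hπ : Function.Bijective π₁ := hbij D a' b' R hgen π₁ rfl rfl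
  refine ⟨π₂.comp (inverseHom π₁ hπ), ?_, ?_⟩
  · change π₂ (inverseHom π₁ hπ (π₁ a')) = c
    rw [inverseHom_apply]; rfl
  · change π₂ (inverseHom π₁ hπ (π₁ b')) = d
    rw [inverseHom_apply]; rfl

section character

variable {q : ℝ} (hq : q ∈ Set.Ioo (0 : ℝ) 1) {k l : ℕ} (hk : 0 < k) (hl : 0 < l)

/-- The character of a unitization whose kernel is the original algebra. -/
noncomputable def fstStarHom (I : Type*) [NonUnitalRing I] [StarRing I] [Module ℂ I]
    [SMulCommClass ℂ I I] [IsScalarTower ℂ I I] [StarModule ℂ I] : Unitization ℂ I →⋆ₐ[ℂ] ℂ :=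
  { Unitization.fstHom ℂ I with map_star' := fun x => Unitization.fst_star x }

/-- The character of the concrete algebra that vanishes on the compact operators. -/
noncomputable def character : CWP hq k l →⋆ₐ[ℂ] ℂ :=
  (fstStarHom (Fin l → compactOps V)).comp
    (inverseHom (unitizationHom hq k l) (unitizationHom_bijective hq k hk hl))

theorem character_unitizationHom (x : Unitization ℂ (Fin l → compactOps V)) :
    character hq hk hl (unitizationHom hq k l x) = x.fst := by
  exact congrArg (fun y : Unitization ℂ (Fin l → compactOps V) => y.fst)
    (inverseHom_apply (unitizationHom hq k l) (unitizationHom_bijective hq k hk hl) x)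

theorem character_genA : character hq hk hl (genA hq k l) = 0 := by
  rw [← unitizationHom_inr_piA hq k hl, character_unitizationHom, Unitization.fst_inr]

theorem character_genB : character hq hk hl (genB hq k l) = 0 := by
  rw [← unitizationHom_inr_piB hq k hk hl, character_unitizationHom, Unitization.fst_inr]

include hk hl in
theorem bijective_of_generators {A : Type*} [CStarAlgebra A] (a b : A) (R : Relations q k l a b)
    (hgen : (StarAlgebra.adjoin ℂ ({a, b} : Set A)).topologicalClosure = ⊤)
    (π : A →⋆ₐ[ℂ] CWP hq k l) (ha : π a = genA hq k l) (hb : π b = genB hq k l) :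
    Function.Bijective π := by
  have hinj := injective_of_generators hq hk hl R hgen (character hq hk hl)
    (character_genA hq hk hl) (character_genB hq hk hl) π ha hb
  exact ⟨hinj, @surjective_of_generators A (CWP hq k l) _ _ a b (genA hq k l) (genB hq k l)
    (generate_gen hq k) π ha hb hinj⟩

theorem isSplitExact_unitization :
    IsSplitExact ((unitizationHom hq k l).toNonUnitalStarAlgHom.comp
      (Unitization.inrNonUnitalStarAlgHom ℂ (Fin l → compactOps V)))
      (character hq hk hl) (StarAlgHom.ofId ℂ (CWP hq k l)) where
  injective := (unitizationHom_injective hq k hl).comp Unitization.inr_injective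
  exact x := by
    obtain ⟨y, rfl⟩ := (unitizationHom_bijective hq k hk hl).2 x
    rw [character_unitizationHom hq hk hl]
    constructor
    · intro h
      exact ⟨y.snd, congrArg (unitizationHom hq k l) (Unitization.ext h.symm rfl)⟩
    · rintro ⟨t, ht⟩
      have := unitizationHom_injective hq k hl ht
      rw [← this]; rfl
  surjective z := ⟨algebraMap ℂ _ z, AlgHomClass.commutes (character hq hk hl) z⟩
  split z := AlgHomClass.commutes (character hq hk hl) z

end character
end WPq

theorem proposition5p1 (q : ℝ) (hq : q ∈ Set.Ioo (0 : ℝ) 1) (k l : ℕ) (hk : 0 < k) (hl : 0 < l)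
    (hkl : Nat.Coprime k l) :
    IsUniversal.{0, v} q k l (genA hq k l) (genB hq k l) ∧
    (∀ (A : Type u) [CStarAlgebra A] (a b : A), IsUniversal.{u, 0} q k l a b →
      ∃ Φ : A ≃⋆ₐ[ℂ] CWP hq k l, Φ a = genA hq k l ∧ Φ b = genB hq k l) ∧
    (∃ (ι : (Fin l → compactOps V) →⋆ₙₐ[ℂ] CWP hq k l) (ε : CWP hq k l →⋆ₐ[ℂ] ℂ)
        (σ : ℂ →⋆ₐ[ℂ] CWP hq k l),
      IsSplitExact ι ε σ ∧
      (∀ T : Fin l → compactOps V,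
        (ι T : VSum l →L[ℂ] VSum l) = blockDiag fun s => (T s : V →L[ℂ] V)) ∧
      ε (genA hq k l) = 0 ∧ ε (genB hq k l) = 0) ∧
    Nonempty (CWP hq k l ≃⋆ₐ[ℂ] Unitization ℂ (Fin l → compactOps V)) := by
  refine ⟨⟨relations_gen hq k, generate_gen hq k, fun B _ c d hcd => ?_⟩, fun A _ a b hU => ?_,
    ⟨_, _, _, isSplitExact_unitization hq hk hl, fun T => ?_, character_genA hq hk hl,
      character_genB hq hk hl⟩, ⟨(StarAlgEquiv.ofBijective (unitizationHom hq k l)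
        (unitizationHom_bijective hq k hk hl)).symm⟩⟩
  · exact exists_hom_of_bijective (relations_gen hq k) hcd
      fun D _ a' b' R hgen π => bijective_of_generators hq hk hl a' b' R hgen π
  -- Universality of `A` is tested only against the concrete algebra, which lives in `Type`; hence
  -- the second universe is `0`. Rigidity does the rest.
  · obtain ⟨π, ha, hb⟩ := hU.lift (CWP hq k l) _ _ (relations_gen hq k)
    exact ⟨StarAlgEquiv.ofBijective π
      (bijective_of_generators hq hk hl a b hU.relations hU.generate π ha hb), ha, hb⟩
  · change algebraMap ℂ (VSum l →L[ℂ] VSum l) 0 + blockHom l T = _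
    rw [map_zero, zero_add]; rfl
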